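/- Notation. Write $(a;q)_\infty=\prod_{i\ge 0}(1-aq^i)$, and define the integers $w_2(n)$ by $$\sum_{n\ge 0} w_2(n)q^n=\frac{(q^2;q^2)_\infty}{(q;q^2)_\infty^4\,(q^2;q^2)_\infty^2}.$$ For a partition $\lambda$ let $\sigma(\lambda)$ be the sum of its parts and $\ell(\lambda)$ the number of its parts (both $0$ for the empty partition). Let $n_1(\lambda)$ be the number of ones in $\lambda$ and $\mu(\lambda)$ the number of parts of $\lambda$ larger than $n_1(\lambda)$. The crank $c(\lambda)$ is the largest part of $\lambda$ if $n_1(\lambda)=0$ (and $0$ if $\lambda$ is empty), and $\mu(\lambda)-n_1(\lambda)$ if $n_1(\lambda)>0$. Let $\mathcal P^*$ be the set $\mathcal P$ of all partitions together with two additional copies $1^*$, $1^{**}$ of the partition $1$. On $\mathcal P^*$ put - $wt^*(1)=-1$ and $wt^*(\lambda)=1$ for every other element $\lambda$ of $\mathcal P^*$; - $c^*(1)=0$, $c^*(1^*)=1$, $c^*(1^{**})=-1$, and $c^*(\lambda)=c(\lambda)$ for $\lambda\in\mathcal P$, $\lambda\ne 1$; - $\sigma^*(1^*)=\sigma^*(1^{**})=1$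 and $\sigma^*(\lambda)=\sigma(\lambda)$ for $\lambda\in\mathcal P$. Let $\mathcal W_2$ be the set of vectors $\vec\lambda=(\lambda_1,\lambda_2,\lambda_3,\lambda_4,\lambda_5,2\lambda_6,2\lambda_7)$ in which $\lambda_1$ is a partition into distinct even parts, $\lambda_2,\dots,\lambda_5$ are partitions into odd parts (repetitions allowed), and $\lambda_6,\lambda_7\in\mathcal P^*$. For $\vec\lambda\in\mathcal W_2$ put $$\widetilde s(\vec\lambda)=\sum_{i=1}^5\sigma(\lambda_i)+2\sigma^*(\lambda_6)+2\sigma^*(\lambda_7),\qquad \widetilde{wt}(\vec\lambda)=(-1)^{\ell(\lambda_1)}\,wt^*(\lambda_6)\,wt^*(\lambda_7),$$ $$c_7(\vec\lambda)=\ell(\lambda_2)-\ell(\lambda_3)+2\bigl(\ell(\lambda_4)-\ell(\lambda_5)\bigr)+c^*(\lambda_6)+2c^*(\lambda_7),$$ and let $$M^*(k,m,n)=\sum_{\substack{\vec\lambda\in\mathcal W_2,\ \widetilde s(\vec\lambda)=n\\ c_7(\vec\lambda)\equiv k\ (\mathrm{mod}\ m)}}\widetilde{wt}(\vec\lambda).$$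 Theorem. For all integers $n\ge 0$, $$M^*(0,7,7n+4)=M^*(1,7,7n+4)=\cdots=M^*(6,7,7n+4)=\frac{w_2(7n+4)}{7}.$$ -/

import Mathlib

namespace VectorCrank

open PowerSeries

/-! ### The weighted 7-colored partition function -/

open scoped PowerSeries.WithPiTopology in
/-- The infinite product `(q^a; q^b)_∞ = ∏_{i ≥ 0} (1 - q^(a + b i))`, as a formal power series
in `q = X` over `ℤ` (for `a, b ≥ 1`). -/
noncomputable def qProd (a b : ℕ) : ℤ⟦X⟧ :=
  ∏' i : ℕ, (1 - (X : ℤ⟦X⟧) ^ (a + b * i))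

open scoped PowerSeries.WithPiTopology in
/-- The infinite product converges. -/
theorem multipliable_qProd (a : ℕ) {b : ℕ} (hb : 0 < b) :
    Multipliable fun i : ℕ => 1 - (X : ℤ⟦X⟧) ^ (a + b * i) := by
  simp_rw [sub_eq_add_neg]
  apply WithPiTopology.multipliable_one_add_of_tendsto_order_atTop_nhds_top
  refine ENat.tendsto_nhds_top_iff_natCast_lt.mpr fun n => Filter.eventually_atTop.mpr
    ⟨n + 1, fun i hi => ?_⟩
  rw [order_neg, order_X_pow]
  have : i ≤ b * i := Nat.le_mul_of_pos_left i hb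
  exact_mod_cast (by omega : n < a + b * i)

open scoped PowerSeries.WithPiTopology in
theorem constantCoeff_qProd {a b : ℕ} (ha : 0 < a) (hb : 0 < b) :
    constantCoeff (qProd a b) = 1 := by
  have h := (multipliable_qProd a hb).map_tprod (constantCoeff (R := ℤ))
    (WithPiTopology.continuous_constantCoeff ℤ)
  rw [qProd, h]
  have : ∀ i : ℕ, (constantCoeff (R := ℤ)) (1 - (X : ℤ⟦X⟧) ^ (a + b * i)) = 1 := by
    intro i
    simp [ha.ne']
  simp [this]

/-- The denominator `(q; q²)_∞⁴ (q^t; q^t)_∞²`. -/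
noncomputable def wDenom (t : ℕ) : ℤ⟦X⟧ := qProd 1 2 ^ 4 * qProd t t ^ 2

/-- The generating function `(q²; q²)_∞ / ((q; q²)_∞⁴ (q^t; q^t)_∞²)` of `w_t` (for `t ≥ 1`). -/
noncomputable def wGenFun (t : ℕ) : ℤ⟦X⟧ := qProd 2 2 * invOfUnit (wDenom t) 1

/-- `wGenFun t` really is the quotient. -/
theorem wGenFun_mul_wDenom {t : ℕ} (ht : 0 < t) : wGenFun t * wDenom t = qProd 2 2 := by
  have h : constantCoeff (wDenom t) = ((1 : ℤˣ) : ℤ) := by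
    simp [wDenom, constantCoeff_qProd, ht]
  rw [wGenFun, mul_assoc, mul_comm (invOfUnit _ _), mul_invOfUnit _ _ h, mul_one]

/-- The number `w_t(n)` of weighted 7-colored partitions of `n`. -/
noncomputable def w (t n : ℕ) : ℤ := coeff n (wGenFun t)

/-! ### Partitions and the crank -/

/-- The set of all partitions (of all natural numbers). -/
abbrev Ptn : Type := Σ n : ℕ, n.Partition

/-- The multiset of parts. -/
def Ptn.parts (l : Ptn) : Multiset ℕ := l.2.parts

/-- The sum `σ(λ)` of the parts of `λ`. -/
def Ptn.size (l : Ptn) : ℕ := l.parts.sum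

/-- The number `ℓ(λ)` of parts of `λ`. -/
def Ptn.length (l : Ptn) : ℕ := l.parts.card

theorem Ptn.size_eq_fst (l : Ptn) : l.size = l.1 := l.2.parts_sum

/-- Partitions into odd parts. -/
def oddParts : Set Ptn := {l | ∀ i ∈ l.parts, Odd i}

/-- Partitions into distinct even parts. -/
def distinctEvenParts : Set Ptn := {l | l.parts.Nodup ∧ ∀ i ∈ l.parts, Even i}

/-- The number of ones in a partition. -/
def Ptn.ones (l : Ptn) : ℕ := l.parts.count 1

/-- The largest part (`0` for the empty partition). -/
def Ptn.largest (l : Ptn) : ℕ := l.parts.sup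

/-- The number of parts larger than the number of ones. -/
def Ptn.mu (l : Ptn) : ℕ := (l.parts.filter (fun i => l.ones < i)).card

/-- The crank of a partition. -/
def Ptn.crank (l : Ptn) : ℤ :=
  if l.ones = 0 then (l.largest : ℤ) else (l.mu : ℤ) - (l.ones : ℤ)

/-- All partitions, together with two additional copies `1*` and `1**` of the partition `1`. -/
inductive PStar : Type
  | ordinary (l : Ptn)
  | oneStar
  | oneStarStar

/-- The weight `wt*`: it is `-1` at the ordinary partition `1`, and `1` elsewhere. -/
def PStar.weight : PStar → ℤ
  | ordinary l => if l.parts = {1} then -1 else 1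
  | oneStar => 1
  | oneStarStar => 1

/-- The modified crank `c*`: `0`, `1`, `-1` at `1`, `1*`, `1**`, and the crank elsewhere. -/
def PStar.crank : PStar → ℤ
  | ordinary l => if l.parts = {1} then 0 else l.crank
  | oneStar => 1
  | oneStarStar => -1

/-- The sum of parts `σ*`. -/
def PStar.size : PStar → ℕ
  | ordinary l => l.size
  | oneStar => 1
  | oneStarStar => 1

/-! ### Vector partitions -/

/-- A vector `(λ₁, λ₂, λ₃, λ₄, λ₅, 2λ₆, 2λ₇)`, recorded through `λ₁, …, λ₇`. -/
@[ext]
structure VecPtn : Type where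
  l1 : Ptn
  l2 : Ptn
  l3 : Ptn
  l4 : Ptn
  l5 : Ptn
  l6 : PStar
  l7 : PStar

/-- The set `W₂` of vector partitions: `λ₁` has distinct even parts, `λ₂, …, λ₅` have odd parts,
`λ₆, λ₇` are arbitrary. -/
def W2 : Set VecPtn :=
  {v | v.l1 ∈ distinctEvenParts ∧ v.l2 ∈ oddParts ∧ v.l3 ∈ oddParts ∧ v.l4 ∈ oddParts ∧
    v.l5 ∈ oddParts}

namespace VecPtn

/-- The sum of parts, in which the parts of `λ₆` and `λ₇` count twice. -/
def size (v : VecPtn) : ℕ :=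
  v.l1.size + v.l2.size + v.l3.size + v.l4.size + v.l5.size + 2 * v.l6.size + 2 * v.l7.size

/-- The weight of a vector partition. -/
def weight (v : VecPtn) : ℤ := (-1) ^ v.l1.length * v.l6.weight * v.l7.weight

/-- The vector crank `c₇`. -/
def crank (v : VecPtn) : ℤ :=
  ((v.l2.length : ℤ) - (v.l3.length : ℤ)) + 2 * ((v.l4.length : ℤ) - (v.l5.length : ℤ)) +
    v.l6.crank + 2 * v.l7.crank

end VecPtn

theorem finite_ptn_size_le (n : ℕ) : {l : Ptn | l.size ≤ n}.Finite := by
  have h : {l : Ptn | l.size ≤ n} ⊆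
      ((Finset.range (n + 1)).sigma fun m => (Finset.univ : Finset m.Partition) : Set Ptn) := by
    intro l hl
    have hl' : l.1 ≤ n := by
      have h1 : l.size ≤ n := hl
      rwa [Ptn.size_eq_fst] at h1
    simp only [Finset.mem_coe, Finset.mem_sigma, Finset.mem_range, Finset.mem_univ, and_true]
    omega
  exact (Finset.finite_toSet _).subset h

theorem finite_pStar_size_le (n : ℕ) : {l : PStar | l.size ≤ n}.Finite := by
  refine (((finite_ptn_size_le n).image PStar.ordinary).union
    (Set.toFinite {PStar.oneStar, PStar.oneStarStar})).subset ?_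
  rintro (l | _ | _) hl
  · exact Or.inl ⟨l, hl, rfl⟩
  · simp
  · simp

theorem finite_vecPtn_size (n : ℕ) : {v : VecPtn | v ∈ W2 ∧ v.size = n}.Finite := by
  have hA := finite_ptn_size_le n
  have hB := finite_pStar_size_le n
  have hP := hA.prod (hA.prod (hA.prod (hA.prod (hA.prod (hB.prod hB)))))
  refine Set.Finite.of_injOn (f := fun v : VecPtn => (v.l1, v.l2, v.l3, v.l4, v.l5, v.l6, v.l7))
    ?_ ?_ hP
  · rintro v ⟨-, hv⟩
    simp only [VecPtn.size] at hv
    simp only [Set.mem_prod, Set.mem_ofPred_eq]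
    refine ⟨?_, ?_, ?_, ?_, ?_, ?_, ?_⟩ <;> omega
  · intro v _ v' _ h
    simp only [Prod.mk.injEq] at h
    obtain ⟨h1, h2, h3, h4, h5, h6, h7⟩ := h
    exact VecPtn.ext h1 h2 h3 h4 h5 h6 h7

/-- The finite set `W₂(n)` of vector partitions in `W₂` with sum of parts `n`. -/
noncomputable def W2Of (n : ℕ) : Finset VecPtn := (finite_vecPtn_size n).toFinset

/-- `M*(k, m, n)`: the weighted count of the vector partitions in `W₂(n)` whose vector crank is
congruent to `k` modulo `m`. -/
noncomputable def MStar (k m : ℤ) (n : ℕ) : ℤ :=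
  ∑ v ∈ (W2Of n).filter (fun v => v.crank ≡ k [ZMOD m]), v.weight

end VectorCrank

set_option linter.unusedSectionVars false

namespace VectorCrank

open PowerSeries Finset Filter
open scoped PowerSeries.WithPiTopology

/-! ### Infinite products of formal power series -/

section QInf

variable {K : Type*} [Field K] [TopologicalSpace K] [IsTopologicalRing K] [T2Space K]

/-! Let `z` mark the vector crank. The crank identity of Andrews and Garvan (`crankGenFun_mul`) at
`q²` gives the factor `(q²;q²)_∞ / ((zq²;q²)_∞ (z⁻¹q²;q²)_∞)` for `λ₆`; the partitions `λ₂, λ₃` into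
odd parts supply the missing odd exponents, and `λ₄, λ₅, λ₇` do the same with `z²`. Hence
(`exists_hasGenFun_vecPtn`) the generating function is `(q²;q²)_∞³ / ((zq)_∞ (z⁻¹q)_∞ (z²q)_∞
(z⁻²q)_∞)`, where `(a)_∞ = (a;q)_∞`.

At a primitive seventh root of unity, multiply numerator and denominator by `(q)_∞ (z³q)_∞
(z⁻³q)_∞`. The denominator becomes `(q⁷;q⁷)_∞`, which does not mix residue classes of exponents
modulo 7. By the triple product (`coeff_triple_product_eq_zero`) the numerator has exponents `N =
a(a+1) + b(b+1)/2`, and the second factor's coefficient contains `∑_{k ≤ 2b} z^(3k)`. Now `8N + 3 =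
2(2a+1)² + (2b+1)²`; if `N ≡ 4 (mod 7)`, this is `0 (mod 7)`, and since `-2` is not a square modulo
7, `7 ∣ 2b+1` and the sum vanishes. So the weighted sum of `z^c₇` is zero at all six primitive roots
(`sum_W2Of_primitiveRoot_eq_zero`), while `z = 1` gives `w 2`; orthogonality of characters finishes
the proof (`seven_mul_mStar`). -/

theorem tendsto_order_of_X_pow_dvd {K : Type*} [Field K] {f : ℕ → K⟦X⟧} (h : ∀ i, X ^ i ∣ f i) :
    Tendsto (fun i => (f i).order) atTop (nhds ⊤) := by
  refine ENat.tendsto_nhds_top_iff_natCast_lt.mpr fun n => eventually_atTop.mpr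
    ⟨n + 1, fun i hi => ?_⟩
  refine lt_of_lt_of_le ?_ (nat_le_order _ i fun j hj => X_pow_dvd_iff.mp (h i) j hj)
  exact_mod_cast hi

theorem multipliable_one_sub {f : ℕ → K⟦X⟧} (h : ∀ i, X ^ i ∣ f i) :
    Multipliable fun i => 1 - f i := by
  simp_rw [sub_eq_add_neg]
  exact WithPiTopology.multipliable_one_add_of_tendsto_order_atTop_nhds_top _
    (tendsto_order_of_X_pow_dvd fun i => (dvd_neg).mpr (h i))

theorem X_pow_dvd_tprod_sub_one {f : ℕ → K⟦X⟧} {n : ℕ} (hf : Multipliable f)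
    (h : ∀ i, X ^ n ∣ f i - 1) : X ^ n ∣ ∏' i, f i - 1 := by
  have hfin : ∀ N, X ^ n ∣ ∏ i ∈ range N, f i - 1 := by
    intro N
    induction N with
    | zero => simp
    | succ N ih =>
      rw [prod_range_succ]
      have := (ih.mul_right (f N)).add (h N)
      convert this using 1
      ring
  rw [X_pow_dvd_iff]
  intro m hm
  have ht := hf.hasProd.tendsto_prod_nat
  rw [WithPiTopology.tendsto_iff_coeff_tendsto] at ht
  have h0 : Tendsto (fun N => coeff m (∏ i ∈ range N, f i)) atTop (nhds (coeff m (1 : K⟦X⟧))) := by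
    refine tendsto_const_nhds.congr fun N => ?_
    have := X_pow_dvd_iff.mp (hfin N) m hm
    rw [map_sub, sub_eq_zero] at this
    exact this.symm
  rw [map_sub, tendsto_nhds_unique (ht m) h0, sub_self]

/-- The infinite product `(a; q)_∞`. -/
noncomputable def qInf (a : K⟦X⟧) : K⟦X⟧ := ∏' i : ℕ, (1 - a * X ^ i)

/-- The finite product `(a; q)_n`. -/
noncomputable def qPoch {K : Type*} [Field K] (a : K⟦X⟧) (n : ℕ) : K⟦X⟧ :=
  ∏ i ∈ range n, (1 - a * X ^ i)

theorem multipliable_qInf (a : K⟦X⟧) : Multipliable fun i : ℕ => 1 - a * X ^ i :=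
  multipliable_one_sub fun _ => dvd_mul_left _ _

theorem qPoch_mul_qInf (a : K⟦X⟧) (n : ℕ) : qPoch a n * qInf (a * X ^ n) = qInf a := by
  have h : ∀ i, 1 - a * X ^ n * X ^ i = 1 - a * X ^ (i + n) := fun i => by ring
  have hm := multipliable_qInf (a * X ^ n)
  rw [qInf, qInf, qPoch]
  simp_rw [h] at hm ⊢
  exact Multipliable.prod_mul_tprod_nat_mul' hm

theorem X_pow_dvd_qInf_sub_one {a : K⟦X⟧} {n : ℕ} (h : X ^ n ∣ a) : X ^ n ∣ qInf a - 1 :=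
  X_pow_dvd_tprod_sub_one (multipliable_qInf a) fun i => by
    rw [sub_sub_cancel_left, dvd_neg]
    exact h.mul_right _

/-- The factors beyond the first `n` are all `1` modulo `X ^ n`. Identities between infinite
products are checked through such congruences instead of limits. -/
theorem X_pow_dvd_qInf_sub_qPoch (a : K⟦X⟧) (n : ℕ) : X ^ n ∣ qInf a - qPoch a n := by
  rw [← qPoch_mul_qInf a n]
  have := (X_pow_dvd_qInf_sub_one (dvd_mul_left (X ^ n) a)).mul_left (qPoch a n)
  convert this using 1
  ring

theorem constantCoeff_qInf {a : K⟦X⟧} (h : constantCoeff a = 0) : constantCoeff (qInf a) = 1 := by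
  have h1 : X ^ 1 ∣ qInf a - 1 := X_pow_dvd_qInf_sub_one (by rwa [pow_one, X_dvd_iff])
  rw [pow_one, X_dvd_iff, map_sub, map_one, sub_eq_zero] at h1
  exact h1

theorem qInf_ne_zero {a : K⟦X⟧} (h : constantCoeff a = 0) : qInf a ≠ 0 := by
  intro h0
  have := constantCoeff_qInf h
  rw [h0] at this
  simp at this

theorem constantCoeff_qPoch {K : Type*} [Field K] {a : K⟦X⟧} (h : constantCoeff a = 0) (n : ℕ) :
    constantCoeff (qPoch a n) = 1 := by
  simp [qPoch, h]

theorem qPoch_ne_zero {K : Type*} [Field K] {a : K⟦X⟧} (h : constantCoeff a = 0) (n : ℕ) :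
    qPoch a n ≠ 0 := by
  intro h0
  have := constantCoeff_qPoch h n
  rw [h0] at this
  simp at this

theorem qPoch_succ {K : Type*} [Field K] (a : K⟦X⟧) (n : ℕ) :
    qPoch a (n + 1) = qPoch a n * (1 - a * X ^ n) := prod_range_succ _ _

theorem qPoch_succ' {K : Type*} [Field K] (a : K⟦X⟧) (n : ℕ) :
    qPoch a (n + 1) = (1 - a) * qPoch (a * X) n := by
  rw [qPoch, prod_range_succ', mul_comm, qPoch]
  simp only [pow_zero, mul_one]
  congr 1
  exact prod_congr rfl fun i _ => by ring

theorem continuous_expand (p : ℕ) (hp : p ≠ 0) : Continuous (expand (R := K) p hp) := by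
  refine continuous_iff_continuousAt.mpr fun f => ?_
  rw [ContinuousAt, WithPiTopology.tendsto_iff_coeff_tendsto]
  intro d
  simp_rw [coeff_expand]
  split_ifs
  · exact ((WithPiTopology.continuous_coeff K (d / p)).tendsto f)
  · exact tendsto_const_nhds

theorem expand_qInf (p : ℕ) (hp : p ≠ 0) (z : K) :
    expand p hp (qInf (C z * X)) = ∏' i : ℕ, (1 - C z * X ^ (p * (i + 1))) := by
  rw [qInf, (multipliable_qInf _).map_tprod _ (continuous_expand p hp)]
  refine tprod_congr fun i => ?_
  rw [map_sub, map_one, map_mul, map_mul, map_pow, expand_X, expand_C]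
  ring

/-- The product `∏ (1 - z q^(2i+1))`. -/
noncomputable def oddProd (z : K) : K⟦X⟧ := ∏' i : ℕ, (1 - C z * X ^ (2 * i + 1))

theorem multipliable_oddProd (z : K) : Multipliable fun i : ℕ => 1 - C z * X ^ (2 * i + 1) :=
  multipliable_one_sub fun i => (pow_dvd_pow X (by omega)).mul_left _

theorem multipliable_evenProd (z : K) : Multipliable fun i : ℕ => 1 - C z * X ^ (2 * (i + 1)) :=
  multipliable_one_sub fun i => (pow_dvd_pow X (by omega)).mul_left _

/-- The factors of `(zq;q)_∞` are split by the parity of the exponent of `q`; `expand` leaves the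
constant `z` untouched. -/
theorem oddProd_mul_expand (z : K) :
    oddProd z * expand 2 two_ne_zero (qInf (C z * X)) = qInf (C z * X) := by
  rw [expand_qInf, oddProd, qInf]
  have h : ∀ i : ℕ, (1 : K⟦X⟧) - C z * X * X ^ i = 1 - C z * X ^ (i + 1) := fun i => by ring
  simp_rw [h]
  exact tprod_even_mul_odd (f := fun i => 1 - C z * X ^ (i + 1)) (multipliable_oddProd z)
    (multipliable_evenProd z)

end QInf

/-! ### The q-binomial theorem -/

section QBinomial

variable {K : Type*} [Field K]

theorem eq_of_forall_X_pow_dvd_sub {f g : K⟦X⟧} (h : ∀ n, X ^ n ∣ f - g) : f = g := by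
  ext n
  have := X_pow_dvd_iff.mp (h (n + 1)) n (Nat.lt_succ_self n)
  rwa [map_sub, sub_eq_zero] at this

/-- The general term of the q-binomial series. -/
noncomputable def qBinomTerm (a t : K⟦X⟧) (j : ℕ) : K⟦X⟧ := qPoch a j * (qPoch X j)⁻¹ * t ^ j

theorem qPoch_X_mul_inv (j : ℕ) : qPoch (X : K⟦X⟧) j * (qPoch X j)⁻¹ = 1 := by
  refine PowerSeries.mul_inv_cancel _ ?_
  rw [constantCoeff_qPoch constantCoeff_X]
  exact one_ne_zero

theorem inv_qPoch_succ_mul (j : ℕ) :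
    (qPoch (X : K⟦X⟧) (j + 1))⁻¹ * (1 - X * X ^ j) = (qPoch X j)⁻¹ := by
  have h1 := qPoch_X_mul_inv (K := K) (j + 1)
  have h2 := qPoch_X_mul_inv (K := K) j
  have h0 := qPoch_ne_zero (K := K) (a := X) constantCoeff_X j
  apply mul_left_cancel₀ h0
  rw [h2]
  generalize (qPoch (X : K⟦X⟧) (j + 1))⁻¹ = u at h1 ⊢
  rw [qPoch_succ] at h1
  linear_combination h1

/-- Passing from `t` to `t * X` produces the factor `1 - X^(j+1)`, which cancels the last factor of
`(q)_(j+1)`; the last factor `1 - a X^j` of `(a)_(j+1)` then splits into the two terms on the right.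
-/
theorem qBinomTerm_succ_sub (a t : K⟦X⟧) (j : ℕ) :
    qBinomTerm a t (j + 1) - qBinomTerm a (t * X) (j + 1) =
      t * qBinomTerm a t j - a * t * qBinomTerm a (t * X) j := by
  simp only [qBinomTerm]
  rw [← inv_qPoch_succ_mul j, qPoch_succ a j]
  ring

variable [TopologicalSpace K]

theorem summable_of_X_pow_dvd {f : ℕ → K⟦X⟧} (h : ∀ i, X ^ i ∣ f i) : Summable f :=
  WithPiTopology.summable_of_tendsto_order_atTop_nhds_top _ (tendsto_order_of_X_pow_dvd h)

theorem summable_qBinomTerm (a : K⟦X⟧) {t : K⟦X⟧} (ht : X ∣ t) : Summable (qBinomTerm a t) :=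
  summable_of_X_pow_dvd fun _ => (pow_dvd_pow_of_dvd ht _).mul_left _

variable [IsTopologicalRing K] [T2Space K]

theorem X_pow_dvd_tsum {f : ℕ → K⟦X⟧} {n : ℕ} (hf : Summable f) (h : ∀ i, X ^ n ∣ f i) :
    X ^ n ∣ ∑' i, f i := by
  rw [X_pow_dvd_iff]
  intro m hm
  rw [hf.map_tsum (coeff m) (WithPiTopology.continuous_coeff K m)]
  simp [X_pow_dvd_iff.mp (h _) m hm]

theorem tsum_qBinomTerm_step (a : K⟦X⟧) {t : K⟦X⟧} (ht : X ∣ t) :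
    (1 - t) * ∑' j, qBinomTerm a t j = (1 - a * t) * ∑' j, qBinomTerm a (t * X) j := by
  have h1 := summable_qBinomTerm a ht
  have h2 := summable_qBinomTerm a (ht.mul_right X)
  have h3 : ∑' j, qBinomTerm a t j - ∑' j, qBinomTerm a (t * X) j =
      t * ∑' j, qBinomTerm a t j - a * t * ∑' j, qBinomTerm a (t * X) j := by
    rw [← h1.tsum_sub h2, (h1.sub h2).tsum_eq_zero_add, ← h1.tsum_mul_left, ← h2.tsum_mul_left,
      ← (h1.mul_left t).tsum_sub (h2.mul_left _)]
    simp only [qBinomTerm_succ_sub]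
    simp [qBinomTerm]
  linear_combination h3

theorem qPoch_mul_tsum_qBinomTerm (a : K⟦X⟧) {t : K⟦X⟧} (ht : X ∣ t) (n : ℕ) :
    qPoch t n * ∑' j, qBinomTerm a t j = qPoch (a * t) n * ∑' j, qBinomTerm a (t * X ^ n) j := by
  induction n with
  | zero => simp [qPoch]
  | succ n ih =>
    have := tsum_qBinomTerm_step a (ht.mul_right (X ^ n))
    rw [mul_assoc t, ← pow_succ] at this
    rw [qPoch_succ, qPoch_succ]
    linear_combination (1 - t * X ^ n) * ih + qPoch (a * t) n * this

/-- The q-binomial theorem. -/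
theorem qInf_mul_tsum_qBinomTerm (a : K⟦X⟧) {t : K⟦X⟧} (ht : X ∣ t) :
    qInf t * ∑' j, qBinomTerm a t j = qInf (a * t) := by
  refine eq_of_forall_X_pow_dvd_sub fun n => ?_
  have h1 := X_pow_dvd_qInf_sub_qPoch t n
  have h2 := X_pow_dvd_qInf_sub_qPoch (a * t) n
  have hs := summable_qBinomTerm a (ht.mul_right (X ^ n))
  -- After `n` uses of the functional equation the remaining series has argument `t * X ^ n`, so
  -- only its term `j = 0` survives modulo `X ^ n`.
  have h3 : X ^ n ∣ ∑' j, qBinomTerm a (t * X ^ n) j - 1 := by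
    rw [hs.tsum_eq_zero_add]
    have : qBinomTerm a (t * X ^ n) 0 = 1 := by simp [qBinomTerm, qPoch]
    rw [this, add_sub_cancel_left]
    refine X_pow_dvd_tsum ((summable_nat_add_iff 1).mpr hs) fun i => ?_
    rw [qBinomTerm, pow_succ (t * X ^ n)]
    exact ((dvd_mul_left _ _).mul_left _).mul_left _
  have h := ((h1.mul_right (∑' j, qBinomTerm a t j)).sub h2).add (h3.mul_left (qPoch (a * t) n))
  convert h using 1
  linear_combination qPoch_mul_tsum_qBinomTerm a ht n

end QBinomial

/-! ### The Jacobi triple product -/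

section GaussBinom

variable {A : Type*} [CommRing A]

/-- Gaussian binomial coefficients. -/
def gaussBinom (q : A) : ℕ → ℕ → A
  | _, 0 => 1
  | 0, _ + 1 => 0
  | n + 1, k + 1 => gaussBinom q n k + q ^ (k + 1) * gaussBinom q n (k + 1)

theorem gaussBinom_zero_right (q : A) (n : ℕ) : gaussBinom q n 0 = 1 := by
  cases n <;> rfl

theorem gaussBinom_succ_succ (q : A) (n k : ℕ) :
    gaussBinom q (n + 1) (k + 1) = gaussBinom q n k + q ^ (k + 1) * gaussBinom q n (k + 1) := rfl

theorem gaussBinom_eq_zero (q : A) {n k : ℕ} (h : n < k) : gaussBinom q n k = 0 := by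
  induction n generalizing k with
  | zero => obtain ⟨k, rfl⟩ := Nat.exists_eq_add_one_of_ne_zero h.ne'; rfl
  | succ n ih =>
    obtain ⟨k, rfl⟩ := Nat.exists_eq_add_one_of_ne_zero (Nat.ne_zero_of_lt h)
    rw [gaussBinom_succ_succ, ih (by omega), ih (by omega)]
    ring

theorem map_gaussBinom {B : Type*} [CommRing B] (f : A →+* B) (q : A) (n k : ℕ) :
    f (gaussBinom q n k) = gaussBinom (f q) n k := by
  induction n generalizing k with
  | zero => cases k <;> simp [gaussBinom]
  | succ n ih => cases k <;> simp [gaussBinom, ih]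

/-- The finite q-binomial theorem, in homogeneous form. -/
theorem prod_add_mul_pow (q x y : A) (n : ℕ) :
    ∏ i ∈ range n, (x + y * q ^ i) =
      ∑ k ∈ range (n + 1), q ^ (k.choose 2) * gaussBinom q n k * y ^ k * x ^ (n - k) := by
  induction n generalizing y with
  | zero => simp [gaussBinom]
  | succ n ih =>
    -- The factor `i = 0` is split off; the others form the product for `y * q`, hence the induction
    -- for all `y`.
    have h : ∀ i, x + y * q ^ (i + 1) = x + y * q * q ^ i := fun i => by ring
    rw [prod_range_succ', pow_zero, mul_one]
    simp_rw [h]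
    rw [ih, mul_add, sum_mul, sum_mul]
    rw [sum_range_succ' _ (n + 1)]
    have e1 : ∀ k ∈ range (n + 1), q ^ ((k + 1).choose 2) * gaussBinom q (n + 1) (k + 1) *
        y ^ (k + 1) * x ^ (n + 1 - (k + 1)) =
        q ^ ((k + 1).choose 2) * q ^ (k + 1) * gaussBinom q n (k + 1) * y ^ (k + 1) * x ^ (n - k) +
        q ^ (k.choose 2) * gaussBinom q n k * (y * q) ^ k * x ^ (n - k) * y := by
      intro k _
      have : (k + 1).choose 2 = k + k.choose 2 := by
        rw [Nat.choose_succ_succ' k 1, Nat.choose_one_right]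
      rw [gaussBinom_succ_succ, this, Nat.add_sub_add_right]
      ring
    rw [sum_congr rfl e1, sum_add_distrib, sum_range_succ' _ n, sum_range_succ (fun k => q ^ ((k + 1).choose 2) * q ^ (k + 1) *
      gaussBinom q n (k + 1) * y ^ (k + 1) * x ^ (n - k)) n]
    rw [gaussBinom_eq_zero q (Nat.lt_succ_self n)]
    have e2 : ∀ k ∈ range n, q ^ ((k + 1).choose 2) * gaussBinom q n (k + 1) * (y * q) ^ (k + 1) *
        x ^ (n - (k + 1)) * x = q ^ ((k + 1).choose 2) * q ^ (k + 1) * gaussBinom q n (k + 1) *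
        y ^ (k + 1) * x ^ (n - k) := by
      intro k hk
      have : n - k = n - (k + 1) + 1 := by have := mem_range.mp hk; omega
      rw [this]
      ring
    rw [sum_congr rfl e2]
    simp only [gaussBinom_zero_right, Nat.choose_zero_succ, pow_zero, Nat.sub_zero]
    ring

/-- The factorial formula without division. The Pascal rule matches it through `1 - q^(n+1) = (1 -
q^(k+1)) + q^(k+1) (1 - q^(n-k))`. -/
theorem prod_mul_gaussBinom (q : A) {n k : ℕ} (h : k ≤ n) :
    (∏ i ∈ range k, (1 - q ^ (i + 1))) * (∏ i ∈ range (n - k), (1 - q ^ (i + 1))) *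
      gaussBinom q n k = ∏ i ∈ range n, (1 - q ^ (i + 1)) := by
  induction n generalizing k with
  | zero => obtain rfl := Nat.le_zero.mp h; simp [gaussBinom]
  | succ n ih =>
    cases k with
    | zero => simp [gaussBinom]
    | succ k =>
      rw [gaussBinom_succ_succ, prod_range_succ _ n, prod_range_succ _ k, Nat.add_sub_add_right]
      have h1 := ih (k := k) (by omega)
      rcases (Nat.le_of_succ_le_succ h).eq_or_lt with rfl | hk
      · rw [gaussBinom_eq_zero q (Nat.lt_succ_self k)]
        linear_combination (1 - q ^ (k + 1)) * h1
      · have h2 := ih (k := k + 1) (by omega)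
        obtain ⟨m, rfl⟩ : ∃ m, n = k + 1 + m := ⟨n - (k + 1), by omega⟩
        have e1 : k + 1 + m - k = m + 1 := by omega
        have e2 : k + 1 + m - (k + 1) = m := by omega
        rw [e1, prod_range_succ _ m] at h1 ⊢
        rw [e2, prod_range_succ _ k] at h2
        linear_combination (1 - q ^ (k + 1)) * h1 + q ^ (k + 1) * (1 - q ^ (m + 1)) * h2

end GaussBinom

section TripleProduct

theorem sum_range_id_eq_choose (n : ℕ) : ∑ i ∈ range n, i = n.choose 2 := by
  rw [sum_range_id, Nat.choose_two_right]

section Domain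

variable {A : Type*} [CommRing A] [IsDomain A]

theorem gaussBinom_symm {q : A} (hq : ∀ i : ℕ, q ^ (i + 1) ≠ 1) {n k l : ℕ} (h : k + l = n) :
    gaussBinom q n k = gaussBinom q n l := by
  have h1 := prod_mul_gaussBinom q (n := n) (k := k) (by omega)
  have h2 := prod_mul_gaussBinom q (n := n) (k := l) (by omega)
  rw [show n - k = l by omega] at h1
  rw [show n - l = k by omega] at h2
  have h0 : ∀ m, ∏ i ∈ range m, (1 - q ^ (i + 1)) ≠ 0 := fun m =>
    prod_ne_zero_iff.mpr fun i _ => sub_ne_zero.mpr (hq i).symm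
  apply mul_left_cancel₀ (mul_ne_zero (h0 k) (h0 l))
  rw [h1, mul_comm (∏ i ∈ range k, _), h2]

/-- The finite q-binomial theorem with `x = q^N`, `y = -z` and `2N+1` factors, after cancelling a
common power of `q`. The terms `k = N - j` and `k = N + 1 + j` are paired because they carry the
same power of `q`. -/
theorem prod_sub_mul_prod_one_sub {q : A} (hq0 : q ≠ 0) (z : A) (N : ℕ) :
    (∏ i ∈ range (N + 1), (q ^ i - z)) * ∏ i ∈ range N, (1 - z * q ^ (i + 1)) =
      ∑ j ∈ range (N + 1), q ^ ((j + 1).choose 2) *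
        (gaussBinom q (2 * N + 1) (N - j) * (-z) ^ (N - j) +
          gaussBinom q (2 * N + 1) (N + 1 + j) * (-z) ^ (N + 1 + j)) := by
  have h := prod_add_mul_pow q (q ^ N) (-z) (2 * N + 1)
  apply mul_left_cancel₀ (pow_ne_zero ((N + 1).choose 2 + N ^ 2) hq0)
  have hl : ∏ i ∈ range (2 * N + 1), (q ^ N + -z * q ^ i) = q ^ ((N + 1).choose 2 + N ^ 2) *
      ((∏ i ∈ range (N + 1), (q ^ i - z)) * ∏ i ∈ range N, (1 - z * q ^ (i + 1))) := by
    rw [show 2 * N + 1 = (N + 1) + N by ring, prod_range_add,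
      ← prod_range_reflect _ (N + 1), pow_add, ← sum_range_id_eq_choose, ← prod_pow_eq_pow_sum,
      ← prod_range_reflect (fun i => q ^ i) (N + 1)]
    have e1 : ∀ i ∈ range (N + 1), q ^ N + -z * q ^ (N + 1 - 1 - i) =
        q ^ (N + 1 - 1 - i) * (q ^ i - z) := by
      intro i hi
      have : N = N - i + i := by have := mem_range.mp hi; omega
      rw [Nat.add_sub_cancel]
      nth_rewrite 1 [this]
      ring
    have e2 : ∀ i ∈ range N, q ^ N + -z * q ^ (N + 1 + i) = q ^ N * (1 - z * q ^ (i + 1)) :=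
      fun i _ => by ring
    rw [prod_congr rfl e1, prod_congr rfl e2, prod_mul_distrib, prod_mul_distrib]
    simp only [prod_const, card_range]
    ring
  rw [← hl, h, show 2 * N + 1 + 1 = (N + 1) + (N + 1) by ring, sum_range_add,
    ← sum_range_reflect _ (N + 1), ← sum_add_distrib, mul_sum]
  refine sum_congr rfl fun j hj => ?_
  obtain ⟨m, rfl⟩ : ∃ m, N = m + j := ⟨N - j, by have := mem_range.mp hj; omega⟩
  have i1 : m + j + 1 - 1 - j = m := by omega
  have i2 : m + j - j = m := by omega
  have i3 : 2 * (m + j) + 1 - m = m + 2 * j + 1 := by omega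
  have i4 : 2 * (m + j) + 1 - (m + j + 1 + j) = m := by omega
  rw [i1, i2, i3, i4]
  have c1 : m.choose 2 + (m + j) * (m + 2 * j + 1) =
      (m + j + 1).choose 2 + (m + j) ^ 2 + (j + 1).choose 2 := by
    have : ((m.choose 2 + (m + j) * (m + 2 * j + 1) : ℕ) : ℚ) =
      ((m + j + 1).choose 2 + (m + j) ^ 2 + (j + 1).choose 2 : ℕ) := by
      push_cast [Nat.cast_choose_two]
      ring
    exact_mod_cast this
  have c2 : (m + j + 1 + j).choose 2 + (m + j) * m =
      (m + j + 1).choose 2 + (m + j) ^ 2 + (j + 1).choose 2 := by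
    have : (((m + j + 1 + j).choose 2 + (m + j) * m : ℕ) : ℚ) =
      ((m + j + 1).choose 2 + (m + j) ^ 2 + (j + 1).choose 2 : ℕ) := by
      push_cast [Nat.cast_choose_two]
      ring
    exact_mod_cast this
  have p1 := congrArg (q ^ ·) c1
  have p2 := congrArg (q ^ ·) c2
  simp only [pow_add q, pow_mul q] at p1 p2 ⊢
  linear_combination gaussBinom q (2 * (m + j) + 1) m * (-z) ^ m * p1 +
    gaussBinom q (2 * (m + j) + 1) (m + j + 1 + j) * (-z) ^ (m + j + 1 + j) * p2

/-- By symmetry of the Gaussian binomials each pair contributes a multiple of `1 - z^(2j+1)`, and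
the factor `q^0 - z` on the left is `1 - z`. Dividing by it leaves geometric sums, which stay
meaningful at `z = 1`. -/
theorem finite_triple_product_of_ne_one {q : A} (hq0 : q ≠ 0) (hq : ∀ i : ℕ, q ^ (i + 1) ≠ 1)
    {z : A} (hz : z ≠ 1) (N : ℕ) :
    (∏ i ∈ range N, (z - q ^ (i + 1))) * ∏ i ∈ range N, (1 - z * q ^ (i + 1)) =
      ∑ j ∈ range (N + 1), (-1) ^ j * q ^ ((j + 1).choose 2) *
        gaussBinom q (2 * N + 1) (N - j) * (z ^ (N - j) * ∑ k ∈ range (2 * j + 1), z ^ k) := by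
  have h := prod_sub_mul_prod_one_sub hq0 z N
  have hs : ∏ i ∈ range N, (q ^ (i + 1) - z) = (-1) ^ N * ∏ i ∈ range N, (z - q ^ (i + 1)) := by
    rw [← card_range N, ← prod_const, card_range, ← prod_mul_distrib]
    exact prod_congr rfl fun i _ => by ring
  rw [prod_range_succ', pow_zero, hs] at h
  have h1 : ((-1) ^ N * (-1) ^ N : A) = 1 := by rw [← mul_pow]; simp
  apply mul_left_cancel₀ (sub_ne_zero.mpr hz.symm)
  have h2 := congrArg ((-1) ^ N * ·) h
  simp only [mul_sum (range (N + 1))] at h2 ⊢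
  rw [show ∀ a b c d : A, d * (a - b) * c = (a - b) * (d * c) by intros; ring] at h2
  refine Eq.trans ?_ (h2.trans (sum_congr rfl fun j hj => ?_))
  · linear_combination -(1 - z) * ((∏ i ∈ range N, (z - q ^ (i + 1))) *
      ∏ i ∈ range N, (1 - z * q ^ (i + 1))) * h1
  · obtain ⟨m, rfl⟩ : ∃ m, N = m + j := ⟨N - j, by have := mem_range.mp hj; omega⟩
    rw [gaussBinom_symm hq (k := m + j + 1 + j) (l := m + j - j) (by omega), Nat.add_sub_cancel]
    have hg : (1 - z) * ∑ k ∈ range (2 * j + 1), z ^ k = 1 - z ^ (2 * j + 1) := mul_neg_geom_sum _ _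
    have s1 : ((-1) ^ m * (-1) ^ m : A) = 1 := by rw [← mul_pow]; simp
    have s2 : ((-1) ^ j * (-1) ^ j : A) = 1 := by rw [← mul_pow]; simp
    rw [neg_pow z m, neg_pow z (m + j + 1 + j)]
    set B := gaussBinom q (2 * (m + j) + 1) m
    set Q := q ^ ((j + 1).choose 2)
    linear_combination -(-1) ^ j * Q * B * z ^ m * hg + (-1) ^ j * Q * B * z ^ m *
      (1 - z ^ (2 * j + 1) * (-1) ^ j * (-1) ^ j) * s1 - (-1) ^ j * Q * B * z ^ m *
      z ^ (2 * j + 1) * s2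

/-- The finite form of the Jacobi triple product identity. -/
theorem finite_triple_product {q : A} (hq0 : q ≠ 0) (hq : ∀ i : ℕ, q ^ (i + 1) ≠ 1)
    (z : A) (N : ℕ) :
    (∏ i ∈ range N, (z - q ^ (i + 1))) * ∏ i ∈ range N, (1 - z * q ^ (i + 1)) =
      ∑ j ∈ range (N + 1), (-1) ^ j * q ^ ((j + 1).choose 2) *
        gaussBinom q (2 * N + 1) (N - j) * (z ^ (N - j) * ∑ k ∈ range (2 * j + 1), z ^ k) := by
  -- The identity is proved for a polynomial variable, which differs from `1`, and then evaluated.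
  -- The case `z = 1` is needed for the cube of `(q)_∞`.
  have h := finite_triple_product_of_ne_one (A := Polynomial A) (q := Polynomial.C q)
    (by simpa using hq0) (fun i hi => hq i (by
      rw [← map_pow, ← map_one Polynomial.C] at hi
      exact Polynomial.C_injective hi)) (z := Polynomial.X) (by simpa using Polynomial.X_ne_C (1 : A)) N
  have h' := congrArg (Polynomial.evalRingHom z) h
  simpa only [map_mul, map_prod, map_sum, map_sub, map_pow, map_gaussBinom, map_neg, map_one,
    Polynomial.coe_evalRingHom, Polynomial.eval_X, Polynomial.eval_C] using h'

end Domain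

variable {K : Type*} [Field K]

theorem qPoch_mul_qPoch_eq_sum {z : K} (hz : z ≠ 0) (N : ℕ) :
    qPoch (C z⁻¹ * X) N * qPoch (C z * X) N =
      ∑ j ∈ range (N + 1), X ^ ((j + 1).choose 2) * gaussBinom X (2 * N + 1) (N - j) *
        C ((-1) ^ j * (z⁻¹ ^ j * ∑ k ∈ range (2 * j + 1), z ^ k)) := by
  have h := finite_triple_product (A := K⟦X⟧) (q := X) X_ne_zero (fun i hi => by
    have := congrArg (constantCoeff (R := K)) hi
    simp at this) (C z) N
  have hu : (C z⁻¹ * C z : K⟦X⟧) = 1 := by rw [← map_mul, inv_mul_cancel₀ hz, map_one]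
  have hl : qPoch (C z⁻¹ * X) N * qPoch (C z * X) N = C z⁻¹ ^ N *
      ((∏ i ∈ range N, (C z - X ^ (i + 1))) * ∏ i ∈ range N, (1 - C z * X ^ (i + 1))) := by
    have h1 : qPoch (C z⁻¹ * X) N = C z⁻¹ ^ N * ∏ i ∈ range N, (C z - X ^ (i + 1)) := by
      have := pow_card_mul_prod (s := range N) (b := (C z⁻¹ : K⟦X⟧))
        (f := fun i => C z - X ^ (i + 1))
      rw [card_range] at this
      rw [this]
      exact prod_congr rfl fun i _ => by linear_combination -hu
    have h2 : qPoch (C z * X) N = ∏ i ∈ range N, (1 - C z * X ^ (i + 1)) :=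
      prod_congr rfl fun i _ => by ring
    rw [h1, h2, mul_assoc]
  rw [hl, h, mul_sum]
  refine sum_congr rfl fun j hj => ?_
  obtain ⟨m, rfl⟩ : ∃ m, N = m + j := ⟨N - j, by have := mem_range.mp hj; omega⟩
  have hm : (C z⁻¹ ^ m * C z ^ m : K⟦X⟧) = 1 := by rw [← mul_pow, hu, one_pow]
  simp only [map_mul, map_pow, map_neg, map_one, map_sum]
  rw [Nat.add_sub_cancel]
  linear_combination X ^ ((j + 1).choose 2) * gaussBinom X (2 * (m + j) + 1) m * (-1) ^ j *
    C z⁻¹ ^ j * (∑ k ∈ range (2 * j + 1), C z ^ k) * hm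

variable [TopologicalSpace K] [IsTopologicalRing K] [T2Space K]

theorem X_pow_dvd_qInf_sub_qPoch_of_le (a : K⟦X⟧) {m n : ℕ} (h : m ≤ n) :
    X ^ m ∣ qInf a - qPoch a n :=
  (pow_dvd_pow X h).trans (X_pow_dvd_qInf_sub_qPoch a n)

/-- In `(q)_k (q)_l · gaussBinom = (q)_n` all three products agree with the unit `(q)_∞` modulo `X ^
m`. -/
theorem X_pow_dvd_qInf_mul_gaussBinom_sub_one {m n k l : ℕ} (hn : k + l = n) (hk : m ≤ k)
    (hl : m ≤ l) : X ^ m ∣ qInf (X : K⟦X⟧) * gaussBinom X n k - 1 := by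
  have hQ : IsUnit (qInf (X : K⟦X⟧)) := by
    rw [PowerSeries.isUnit_iff_constantCoeff, constantCoeff_qInf constantCoeff_X]
    exact isUnit_one
  have h := prod_mul_gaussBinom (X : K⟦X⟧) (n := n) (k := k) (by omega)
  have hp : ∀ r, ∏ i ∈ range r, (1 - X ^ (i + 1)) = qPoch (X : K⟦X⟧) r := fun r =>
    prod_congr rfl fun i _ => by ring
  rw [show n - k = l by omega, hp, hp, hp] at h
  have hk' := X_pow_dvd_qInf_sub_qPoch_of_le (X : K⟦X⟧) hk
  have hl' := X_pow_dvd_qInf_sub_qPoch_of_le (X : K⟦X⟧) hl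
  have hn' := X_pow_dvd_qInf_sub_qPoch_of_le (X : K⟦X⟧) (show m ≤ n by omega)
  rw [← hQ.dvd_mul_left]
  convert (((hk'.mul_right (qInf X)).add (hl'.mul_left (qPoch X k))).mul_right
    (gaussBinom X n k)).sub hn' using 1
  linear_combination h

/-- A consequence of the Jacobi triple product identity: the support of
`(q;q)_∞ (zq;q)_∞ (z⁻¹q;q)_∞`. -/
theorem coeff_triple_product_eq_zero {z : K} (hz : z ≠ 0) {d : ℕ}
    (h : ∀ j : ℕ, d = (j + 1).choose 2 → ∑ k ∈ range (2 * j + 1), z ^ k = 0) :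
    coeff d (qInf X * (qInf (C z⁻¹ * X) * qInf (C z * X))) = 0 := by
  -- With `N = 2d + 1`, both `N - j` and `N + 1 + j` exceed `d` for every `j ≤ d`, so each relevant
  -- Gaussian binomial is `1/(q)_∞` up to degree `d`.
  have hle : d + 1 ≤ 2 * d + 1 := by omega
  have h1 := X_pow_dvd_qInf_sub_qPoch_of_le (C z⁻¹ * X) hle
  have h2 := X_pow_dvd_qInf_sub_qPoch_of_le (C z * X) hle
  have h3 : X ^ (d + 1) ∣ qInf X * (qInf (C z⁻¹ * X) * qInf (C z * X)) -
      qInf X * (qPoch (C z⁻¹ * X) (2 * d + 1) * qPoch (C z * X) (2 * d + 1)) := by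
    convert ((h1.mul_right (qInf (C z * X))).add
      (h2.mul_left (qPoch (C z⁻¹ * X) (2 * d + 1)))).mul_left (qInf X) using 1
    ring
  have h4 := X_pow_dvd_iff.mp h3 d (Nat.lt_succ_self d)
  rw [map_sub, sub_eq_zero] at h4
  rw [h4, qPoch_mul_qPoch_eq_sum hz, mul_sum, map_sum]
  refine sum_eq_zero fun j _ => ?_
  set s := (-1) ^ j * (z⁻¹ ^ j * ∑ k ∈ range (2 * j + 1), z ^ k) with hs
  rcases lt_or_ge d ((j + 1).choose 2) with hd | hd
  · refine X_pow_dvd_iff.mp ?_ d hd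
    rw [mul_assoc]
    exact (dvd_mul_right _ _).mul_left _
  · have hj : j ≤ d := by
      refine le_trans ?_ hd
      rw [Nat.choose_succ_succ' j 1, Nat.choose_one_right]
      omega
    have h5 := X_pow_dvd_qInf_mul_gaussBinom_sub_one (K := K) (m := d + 1)
      (n := 2 * (2 * d + 1) + 1) (k := 2 * d + 1 - j) (l := 2 * d + 2 + j) (by omega) (by omega)
      (by omega)
    have h6 : X ^ (d + 1) ∣ qInf X * (X ^ ((j + 1).choose 2) *
        gaussBinom X (2 * (2 * d + 1) + 1) (2 * d + 1 - j) * C s) -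
        X ^ ((j + 1).choose 2) * C s := by
      convert h5.mul_left (X ^ ((j + 1).choose 2) * C s) using 1
      ring
    have h7 := X_pow_dvd_iff.mp h6 d (Nat.lt_succ_self d)
    rw [map_sub, sub_eq_zero] at h7
    rw [h7, coeff_mul_C, coeff_X_pow]
    split_ifs with hdj
    · rw [hs, h j hdj]
      ring
    · ring

end TripleProduct

/-! ### Generating functions of partitions with multiplicative weights -/

section GenFun

open Nat.Partition

variable {K : Type*} [Field K] [TopologicalSpace K] [IsTopologicalRing K] [T2Space K]

theorem genFun_mul_tprod {f : ℕ → ℕ → K} {u v : ℕ → K⟦X⟧} (hu : Multipliable u)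
    (h : ∀ i, (1 + ∑' j, f (i + 1) (j + 1) • (X : K⟦X⟧) ^ ((i + 1) * (j + 1))) * u i = v i) :
    genFun f * ∏' i, u i = ∏' i, v i := by
  rw [genFun_eq_tprod, ← (multipliable_genFun f).tprod_mul hu]
  exact tprod_congr h

theorem one_add_tsum_geometric_mul {i : ℕ} {g : ℕ → K} {t : K} (h : ∀ j, g (j + 1) = t ^ (j + 1)) :
    (1 + ∑' j, g (j + 1) • (X : K⟦X⟧) ^ ((i + 1) * (j + 1))) * (1 - C t * X ^ (i + 1)) = 1 := by
  have h0 : constantCoeff (C t * X ^ (i + 1) : K⟦X⟧) = 0 := by simp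
  have h1 := WithPiTopology.tsum_pow_mul_one_sub_of_constantCoeff_eq_zero h0
  rw [(WithPiTopology.summable_pow_of_constantCoeff_eq_zero h0).tsum_eq_zero_add, pow_zero] at h1
  rw [← h1]
  congr 3
  funext j
  rw [h, smul_eq_C_mul, map_pow, mul_pow, pow_mul]

theorem one_add_tsum_single {i c : ℕ} {g : ℕ → K} {s : K}
    (h : ∀ j, g (j + 1) = if j + 1 = c + 1 then s else 0) :
    1 + ∑' j, g (j + 1) • (X : K⟦X⟧) ^ ((i + 1) * (j + 1)) =
      1 + C s * X ^ ((i + 1) * (c + 1)) := by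
  rw [tsum_eq_single c]
  · rw [h, if_pos rfl, smul_eq_C_mul]
  · intro j hj
    rw [h, if_neg (by omega), zero_smul]

theorem toFinsupp_prod_mul_pow {K : Type*} [Field K] (s : Multiset ℕ) (A : ℕ → K) (t : ℕ → K) :
    (Multiset.toFinsupp s).prod (fun i c => (if i = 1 then A c else 1) * t i ^ c) =
      (if s.count 1 = 0 then 1 else A (s.count 1)) * (s.map t).prod := by
  rw [Finsupp.prod, prod_mul_distrib, Finset.prod_multiset_map_count]
  simp only [Multiset.toFinsupp_support, Multiset.toFinsupp_apply]
  congr 1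
  rw [prod_ite_eq']
  by_cases h : 1 ∈ s
  · simp [h]
  · simp [h]

/-- The weight function in which a part `i > 1` carries `t i`, and `c` ones carry `A c`. -/
noncomputable def onesWeight {K : Type*} [Field K] (A : ℕ → K) (t : ℕ → K) (i c : ℕ) : K :=
  (if i = 1 then A c else 1) * t i ^ c

theorem coeff_genFun_onesWeight {K : Type*} [Field K] (A : ℕ → K) (t : ℕ → K) (n : ℕ) :
    coeff n (genFun (onesWeight A t)) = ∑ p : n.Partition,
      (if p.parts.count 1 = 0 then 1 else A (p.parts.count 1)) * (p.parts.map t).prod := by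
  rw [coeff_genFun]
  exact sum_congr rfl fun p _ => toFinsupp_prod_mul_pow _ _ _

theorem multipliable_one_sub_C_mul (t : ℕ → K) :
    Multipliable fun i : ℕ => 1 - C (t i) * X ^ (i + 2) :=
  multipliable_one_sub fun i => (pow_dvd_pow X (by omega)).mul_left _

/-- Each part size above `1` gives a geometric series cancelled by its factor, so only the ones
remain. The value `A 0` plays no role: an absent part contributes `1`. -/
theorem genFun_onesWeight_mul (A : ℕ → K) {t : ℕ → K} (ht : t 1 = 1) :
    genFun (onesWeight A t) * ∏' i : ℕ, (1 - C (t (i + 2)) * X ^ (i + 2)) =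
      1 + ∑' j, A (j + 1) • (X : K⟦X⟧) ^ (j + 1) := by
  set u : ℕ → K⟦X⟧ := fun i => 1 - if i = 0 then 0 else C (t (i + 1)) * X ^ (i + 1) with hu
  have hm := multipliable_one_sub_C_mul (fun i => t (i + 2))
  have hum : Multipliable u := multipliable_one_sub fun i => by
    split_ifs
    · exact dvd_zero _
    · exact (pow_dvd_pow X (by omega)).mul_left _
  have hu' : ∏' i, u i = ∏' i : ℕ, (1 - C (t (i + 2)) * X ^ (i + 2)) := by
    rw [← Multipliable.prod_mul_tprod_nat_mul' (f := u) (k := 1) hm]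
    simp [hu]
  rw [← hu', genFun_mul_tprod (v := fun i => if i = 0 then
    1 + ∑' j, A (j + 1) • (X : K⟦X⟧) ^ (j + 1) else 1) hum, tprod_ite_eq]
  intro i
  rcases i with _ | i
  · simp [hu, onesWeight, ht]
  · simp only [hu, Nat.add_eq_zero_iff, one_ne_zero, and_false, if_false]
    exact one_add_tsum_geometric_mul (i := i + 1) (g := onesWeight A t (i + 1 + 1))
      (t := t (i + 1 + 1)) fun j => by simp [onesWeight]

end GenFun

/-! ### The generating function of the crank -/

section Crank

open Nat.Partition

variable {K : Type*} [Field K]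

/-- The generating function of the partitions without ones whose parts are at most `m`. -/
noncomputable def boundedGenFun (K : Type*) [Field K] (m : ℕ) : K⟦X⟧ :=
  genFun (onesWeight (fun _ => 0) fun i => if i ≤ m then 1 else 0)

/-- The generating function of the partitions with exactly `j` ones, for `j ≥ 1`, in which `z`
marks the crank. -/
noncomputable def onesGenFun (z : K) (j : ℕ) : K⟦X⟧ :=
  genFun (onesWeight (fun c => if c = j then z⁻¹ ^ j else 0) fun i => if i ≤ j then 1 else z) -
    genFun (onesWeight (fun _ => 0) fun i => if i ≤ j then 1 else z)

theorem prod_map_ite_one {s : Multiset ℕ} (m : ℕ) (z : K) :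
    (s.map fun i => if i ≤ m then 1 else z).prod = z ^ (s.filter fun i => m < i).card := by
  induction s using Multiset.induction_on with
  | empty => simp
  | cons a s ih =>
    rw [Multiset.map_cons, Multiset.prod_cons, ih]
    by_cases h : a ≤ m
    · rw [if_pos h, Multiset.filter_cons_of_neg _ (not_lt.mpr h), one_mul]
    · rw [if_neg h, Multiset.filter_cons_of_pos _ (not_le.mp h), Multiset.card_cons, pow_succ']

/-- The first series in `onesGenFun` also counts the partitions without ones, since multiplicity
zero contributes `1`; the second removes exactly these. -/
theorem coeff_onesGenFun {z : K} {j : ℕ} (hj : j ≠ 0) (n : ℕ) :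
    coeff n (onesGenFun z j) = ∑ p : n.Partition,
      if p.parts.count 1 = j then z⁻¹ ^ j * z ^ (p.parts.filter fun i => j < i).card else 0 := by
  rw [onesGenFun, map_sub, coeff_genFun_onesWeight, coeff_genFun_onesWeight, ← sum_sub_distrib]
  refine sum_congr rfl fun p _ => ?_
  rw [prod_map_ite_one]
  by_cases h0 : p.parts.count 1 = 0
  · rw [if_pos h0, if_pos h0, if_neg (by omega), sub_self]
  · rw [if_neg h0, if_neg h0]
    split_ifs <;> ring

/-- Parts above the bound have weight `0`, and `0 ^ 0 = 1`, so each series detects a bound on the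
largest part; the difference isolates one value of it. -/
theorem coeff_boundedGenFun_sub (m n : ℕ) :
    coeff n (boundedGenFun K (m + 1)) - coeff n (boundedGenFun K m) = ∑ p : n.Partition,
      if p.parts.count 1 = 0 ∧ p.parts.sup = m + 1 then 1 else 0 := by
  rw [boundedGenFun, boundedGenFun, coeff_genFun_onesWeight, coeff_genFun_onesWeight,
    ← sum_sub_distrib]
  refine sum_congr rfl fun p _ => ?_
  have h (k : ℕ) : (p.parts.map fun i => if i ≤ k then (1 : K) else 0).prod =
      if p.parts.sup ≤ k then 1 else 0 := by
    rw [prod_map_ite_one, zero_pow_eq]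
    simp only [Multiset.card_eq_zero, Multiset.filter_eq_nil, Multiset.sup_le, not_lt]
  rw [h, h]
  by_cases h0 : p.parts.count 1 = 0
  · simp only [h0, if_true, one_mul, true_and]
    split_ifs <;> first | omega | simp
  · simp [h0]

variable [TopologicalSpace K] [IsTopologicalRing K] [T2Space K]

theorem qPoch_mul_tprod_eq (z : K) (m : ℕ) :
    ∏' i : ℕ, (1 - C (if i + 2 ≤ m + 1 then (1 : K) else z) * X ^ (i + 2)) =
      qPoch (X * X) m * qInf (C z * X * X ^ (m + 1)) := by
  set f : ℕ → K⟦X⟧ := fun i => 1 - C (if i + 2 ≤ m + 1 then (1 : K) else z) * X ^ (i + 2) with hf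
  have h1 : ∏ i ∈ range m, f i = qPoch (X * X) m := by
    refine prod_congr rfl fun i hi => ?_
    rw [hf]
    simp only
    rw [if_pos (by have := mem_range.mp hi; omega), map_one]
    ring
  have h2 : ∀ i, f (i + m) = 1 - C z * X * X ^ (m + 1) * X ^ i := by
    intro i
    rw [hf]
    simp only
    rw [if_neg (by omega)]
    ring
  have hm : Multipliable fun i => f (i + m) := by
    simp_rw [h2]
    exact multipliable_qInf _
  rw [← Multipliable.prod_mul_tprod_nat_mul' hm, h1, qInf]
  simp_rw [h2]

theorem qInf_X_mul_X : (1 - X) * qInf (X * X : K⟦X⟧) = qInf X := by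
  have := qPoch_mul_qInf (X : K⟦X⟧) 1
  simpa [qPoch] using this

theorem qInf_zero : qInf (0 : K⟦X⟧) = 1 := by
  simp [qInf]

theorem boundedGenFun_eq (m : ℕ) :
    boundedGenFun K (m + 1) = (1 - X) * (qPoch X (m + 1))⁻¹ := by
  have h := genFun_onesWeight_mul (K := K) (fun _ => 0)
    (t := fun i => if i ≤ m + 1 then 1 else 0) (by simp)
  rw [qPoch_mul_tprod_eq, map_zero, zero_mul, zero_mul, qInf_zero] at h
  simp only [zero_smul, tsum_zero, add_zero, mul_one] at h
  have h1 := qPoch_X_mul_inv (K := K) (m + 1)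
  generalize (qPoch (X : K⟦X⟧) (m + 1))⁻¹ = u at h1 ⊢
  rw [qPoch_succ'] at h1
  rw [boundedGenFun]
  linear_combination (1 - X) * u * h -
    genFun (onesWeight (fun _ => (0 : K)) fun i => if i ≤ m + 1 then 1 else 0) * h1

/-- Since `1/(q)_(k+2) - 1/(q)_(k+1) = q^(k+2)/(q)_(k+2)`, the partitions without ones, sorted by
largest part, run through Euler's series, the case `a = 0` of the q-binomial series. -/
theorem C_mul_boundedGenFun_sub (z : K) (k : ℕ) :
    C (z ^ (k + 2)) * (boundedGenFun K (k + 2) - boundedGenFun K (k + 1)) =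
      (1 - X) * qBinomTerm 0 (C z * X) (k + 2) := by
  rw [boundedGenFun_eq, boundedGenFun_eq, ← inv_qPoch_succ_mul (k + 1), qBinomTerm]
  simp only [qPoch, zero_mul, sub_zero, prod_const_one, map_pow]
  ring

/-- With `j = k + 1` ones, the parts `2, …, j` do not count for the crank and larger parts carry
`z`, giving `z⁻ʲ qʲ / ((q²;q)_(j-1) (zq^(j+1);q)_∞)`. Multiplication by `(zq)_∞` leaves `(zq)_j` in
the numerator. -/
theorem onesGenFun_mul (z : K) (k : ℕ) :
    onesGenFun z (k + 1) * qInf (C z * X) =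
      (1 - X) * qBinomTerm (C z * X) (C z⁻¹ * X) (k + 1) := by
  have h1 := genFun_onesWeight_mul (K := K) (fun c => if c = k + 1 then z⁻¹ ^ (k + 1) else 0)
    (t := fun i => if i ≤ k + 1 then 1 else z) (by simp)
  have h2 := genFun_onesWeight_mul (K := K) (fun _ => 0)
    (t := fun i => if i ≤ k + 1 then 1 else z) (by simp)
  have h3 := one_add_tsum_single (K := K) (i := 0) (c := k)
    (g := fun c => if c = k + 1 then z⁻¹ ^ (k + 1) else 0) (fun _ => rfl)
  simp only [zero_add, one_mul] at h3
  rw [qPoch_mul_tprod_eq, h3] at h1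
  rw [qPoch_mul_tprod_eq] at h2
  simp only [zero_smul, tsum_zero, add_zero] at h2
  have h4 := qPoch_X_mul_inv (K := K) (k + 1)
  rw [← qPoch_mul_qInf _ (k + 1), onesGenFun, qBinomTerm]
  generalize (qPoch (X : K⟦X⟧) (k + 1))⁻¹ = u at h4 ⊢
  rw [qPoch_succ'] at h4
  generalize genFun (onesWeight (fun c => if c = k + 1 then z⁻¹ ^ (k + 1) else 0)
    fun i => if i ≤ k + 1 then 1 else z) = F at h1 ⊢
  generalize genFun (onesWeight (fun _ => (0 : K)) fun i => if i ≤ k + 1 then 1 else z) = G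
    at h2 ⊢
  rw [map_pow] at h1
  generalize qPoch (C z * X) (k + 1) = P
  linear_combination (1 - X) * u * P * (h1 - h2) -
    (F - G) * P * qInf (C z * X * X ^ (k + 1)) * h4

/-- The generating function of the crank of partitions. -/
noncomputable def crankGenFun {K : Type*} [Field K] (z : K) : K⟦X⟧ :=
  PowerSeries.mk fun n => ∑ p : n.Partition, z ^ Ptn.crank ⟨n, p⟩

theorem count_le_of_partition {n : ℕ} (p : n.Partition) (i : ℕ) : p.parts.count i ≤ n := by
  refine (Multiset.count_le_card i _).trans ?_
  have := Multiset.card_nsmul_le_sum (s := p.parts) (a := 1) fun x hx => p.parts_pos hx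
  rwa [p.parts_sum, smul_eq_mul, mul_one] at this

theorem zpow_crank_eq {K : Type*} [Field K] {z : K} (hz : z ≠ 0) {n : ℕ} (hn : n ≠ 0)
    (p : n.Partition) :
    z ^ Ptn.crank ⟨n, p⟩ =
      (∑ k ∈ range n, z ^ (k + 2) *
        if p.parts.count 1 = 0 ∧ p.parts.sup = k + 1 + 1 then 1 else 0) +
      ∑ k ∈ range n, if p.parts.count 1 = k + 1 then
        z⁻¹ ^ (k + 1) * z ^ (p.parts.filter fun i => k + 1 < i).card else 0 := by
  have hcount := count_le_of_partition p 1
  change z ^ (if p.parts.count 1 = 0 then (p.parts.sup : ℤ) else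
    ((p.parts.filter fun i => p.parts.count 1 < i).card : ℤ) - (p.parts.count 1 : ℤ)) = _
  by_cases h0 : p.parts.count 1 = 0
  · have hsup : p.parts.sup ≤ n := Multiset.sup_le.mpr fun _ hb => p.le_of_mem_parts hb
    -- A nonempty partition without ones has largest part at least `2`, whence the shift by `2` in
    -- the first sum.
    have hsup2 : 2 ≤ p.parts.sup := by
      have hne : p.parts ≠ 0 := fun h => hn (by rw [← p.parts_sum, h, Multiset.sum_zero])
      obtain ⟨a, ha⟩ := Multiset.exists_mem_of_ne_zero hne
      have h1 := p.parts_pos ha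
      have h2 : a ≠ 1 := fun h => Multiset.count_eq_zero.mp h0 (h ▸ ha)
      exact le_trans (by omega) (Multiset.le_sup ha)
    rw [if_pos h0, zpow_natCast, sum_eq_single (p.parts.sup - 2)]
    · rw [if_pos ⟨h0, by omega⟩, Nat.sub_add_cancel hsup2, mul_one, sum_eq_zero, add_zero]
      intro k _
      rw [if_neg (by omega)]
    · intro k _ hk
      rw [if_neg (by omega), mul_zero]
    · intro h
      exact absurd (mem_range.mpr (by omega)) h
  · rw [if_neg h0, sum_eq_zero, zero_add, sum_eq_single (p.parts.count 1 - 1)]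
    · rw [if_pos (by omega), Nat.sub_add_cancel (by omega), zpow_sub₀ hz, zpow_natCast,
        zpow_natCast, inv_pow, mul_comm, div_eq_mul_inv, mul_comm]
    · intro k _ hk
      rw [if_neg (by omega)]
    · intro h
      exact absurd (mem_range.mpr (by omega)) h
    · intro k _
      rw [if_neg (fun h => h0 h.1), mul_zero]

theorem coeff_tsum_eq_sum_range {f : ℕ → K⟦X⟧} (h : ∀ k, X ^ (k + 1) ∣ f k) (n : ℕ) :
    coeff n (∑' k, f k) = ∑ k ∈ range n, coeff n (f k) := by
  have hs : Summable f := summable_of_X_pow_dvd fun i => (pow_dvd_pow X (by omega)).trans (h i)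
  rw [hs.map_tsum (coeff n) (WithPiTopology.continuous_coeff K n), tsum_eq_sum]
  intro k hk
  exact X_pow_dvd_iff.mp (h k) n (by have := mem_range.not.mp hk; omega)

theorem isUnit_qInf {a : K⟦X⟧} (h : constantCoeff a = 0) : IsUnit (qInf a) := by
  rw [PowerSeries.isUnit_iff_constantCoeff, constantCoeff_qInf h]
  exact isUnit_one

theorem X_pow_dvd_qBinomTerm (a b : K⟦X⟧) (n : ℕ) : X ^ n ∣ qBinomTerm a (b * X) n := by
  rw [qBinomTerm, mul_pow]
  exact (dvd_mul_left _ _).mul_left _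

theorem X_pow_dvd_C_mul_boundedGenFun_sub (z : K) (k : ℕ) :
    X ^ (k + 1) ∣ C (z ^ (k + 2)) * (boundedGenFun K (k + 2) - boundedGenFun K (k + 1)) := by
  rw [C_mul_boundedGenFun_sub]
  exact ((pow_dvd_pow X (by omega)).trans (X_pow_dvd_qBinomTerm _ _ (k + 2))).mul_left _

theorem X_pow_dvd_onesGenFun (z : K) (k : ℕ) : X ^ (k + 1) ∣ onesGenFun z (k + 1) := by
  rw [← (isUnit_qInf (a := C z * X) (by simp)).dvd_mul_right, onesGenFun_mul]
  exact (X_pow_dvd_qBinomTerm _ _ _).mul_left _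

theorem crankGenFun_eq {z : K} (hz : z ≠ 0) :
    crankGenFun z = 1 +
      ∑' k, C (z ^ (k + 2)) * (boundedGenFun K (k + 2) - boundedGenFun K (k + 1)) +
      ∑' k, onesGenFun z (k + 1) := by
  ext n
  rw [map_add, map_add, coeff_tsum_eq_sum_range (X_pow_dvd_C_mul_boundedGenFun_sub z),
    coeff_tsum_eq_sum_range (X_pow_dvd_onesGenFun z), crankGenFun, coeff_mk, coeff_one]
  rcases eq_or_ne n 0 with rfl | hn
  · simp [Ptn.crank, Ptn.ones, Ptn.largest, Ptn.parts]
  · rw [if_neg hn, zero_add]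
    simp only [coeff_C_mul, map_sub, coeff_boundedGenFun_sub,
      coeff_onesGenFun (Nat.succ_ne_zero _), mul_sum]
    rw [sum_comm, sum_comm (s := range n), ← sum_add_distrib]
    exact sum_congr rfl fun p _ => zpow_crank_eq hz hn p

/-- The generating function identity of Andrews and Garvan for the crank. -/
theorem crankGenFun_mul {z : K} (hz : z ≠ 0) :
    (crankGenFun z - (1 - C z) * X) * (qInf (C z * X) * qInf (C z⁻¹ * X)) = qInf X := by
  have hd (w : K) : (X : K⟦X⟧) ∣ C w * X := dvd_mul_left _ _
  have s0 := summable_qBinomTerm (0 : K⟦X⟧) (hd z)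
  have s1 := summable_qBinomTerm (C z * X) (hd z⁻¹)
  have e0 := qInf_mul_tsum_qBinomTerm (0 : K⟦X⟧) (hd z)
  have e1 := qInf_mul_tsum_qBinomTerm (C z * X) (hd z⁻¹)
  have hzz : C z * X * (C z⁻¹ * X) = (X * X : K⟦X⟧) := by
    have : (C z * C z⁻¹ : K⟦X⟧) = 1 := by rw [← map_mul, mul_inv_cancel₀ hz, map_one]
    linear_combination X * X * this
  rw [zero_mul, qInf_zero] at e0
  rw [hzz] at e1
  have hX := qInf_X_mul_X (K := K)
  have t1 : (1 - X) * qBinomTerm 0 (C z * X) 1 = C z * X := by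
    have := qPoch_X_mul_inv (K := K) 1
    generalize hu : (qPoch (X : K⟦X⟧) 1)⁻¹ = u at this
    simp only [qPoch, range_one, prod_singleton, pow_zero, mul_one] at this
    rw [qBinomTerm, hu]
    simp only [qPoch, zero_mul, sub_zero, prod_const_one]
    linear_combination C z * X * this
  have t0 : ∀ a b : K⟦X⟧, qBinomTerm a b 0 = 1 := fun a b => by simp [qBinomTerm, qPoch]
  -- Largest parts start at `2`, so the terms `j = 0, 1` of Euler's series are removed. The term `j
  -- = 1` is `C z * X`, which is the source of the correction at `n = 1`.
  have h0 : ∑' k, C (z ^ (k + 2)) * (boundedGenFun K (k + 2) - boundedGenFun K (k + 1)) =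
      (1 - X) * (∑' k, qBinomTerm 0 (C z * X) k) - (1 - X) - C z * X := by
    simp_rw [C_mul_boundedGenFun_sub]
    rw [((summable_nat_add_iff 2).mpr s0).tsum_mul_left, ← s0.sum_add_tsum_nat_add 2,
      sum_range_succ, range_one, sum_singleton, t0]
    linear_combination -t1
  have h1 : (∑' k, onesGenFun z (k + 1)) * qInf (C z * X) =
      (1 - X) * (∑' k, qBinomTerm (C z * X) (C z⁻¹ * X) k) - (1 - X) := by
    have hs : Summable fun k => onesGenFun z (k + 1) := summable_of_X_pow_dvd fun i =>
      (pow_dvd_pow X (by omega)).trans (X_pow_dvd_onesGenFun z i)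
    rw [← hs.tsum_mul_right]
    simp_rw [onesGenFun_mul]
    rw [((summable_nat_add_iff 1).mpr s1).tsum_mul_left, s1.tsum_eq_zero_add, t0]
    ring
  rw [crankGenFun_eq hz, h0]
  -- Euler's series times `(zq)_∞` is `1` and cancels the missing `j = 0` term of the other series,
  -- which sums to `(q²;q)_∞ / (z⁻¹q)_∞` by the q-binomial theorem.
  linear_combination qInf (C z⁻¹ * X) * h1 + (1 - X) * qInf (C z⁻¹ * X) * e0 + (1 - X) * e1 + hX

end Crank

/-! ### Weighted families with a size function -/

section HasGenFun

variable {K : Type*} [Field K] [TopologicalSpace K]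

/-- `F` is the generating function of the weight `φ` with respect to `size`, where only finitely
many elements have bounded size. -/
structure HasGenFun {α : Type*} (size : α → ℕ) (φ : α → K) (F : K⟦X⟧) : Prop where
  finite : ∀ n, {a | size a ≤ n}.Finite
  hasSum : HasSum (fun a => C (φ a) * X ^ size a) F

theorem coeff_C_mul_X_pow_eq_ite (x : K) (m n : ℕ) :
    coeff n (C x * X ^ m : K⟦X⟧) = if m = n then x else 0 := by
  rw [coeff_C_mul, coeff_X_pow]
  split_ifs <;> first | omega | simp

theorem summable_of_finite_size_le {α : Type*} {size : α → ℕ} (φ : α → K)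
    (h : ∀ n, {a | size a ≤ n}.Finite) : Summable fun a => (C (φ a) * X ^ size a : K⟦X⟧) := by
  rw [WithPiTopology.summable_iff_summable_coeff]
  intro n
  refine summable_of_hasFiniteSupport ((h n).subset fun a ha => ?_)
  rw [Function.mem_support, coeff_C_mul_X_pow_eq_ite] at ha
  by_contra hn
  exact ha (if_neg fun h' => hn h'.le)

theorem HasGenFun.coeff_eq [T2Space K] {α : Type*} {size : α → ℕ} {φ : α → K} {F : K⟦X⟧}
    (h : HasGenFun size φ F) {n : ℕ} {s : Finset α} (hs : ∀ a ∈ s, size a = n)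
    (hs' : ∀ a, size a = n → a ∉ s → φ a = 0) : coeff n F = ∑ a ∈ s, φ a := by
  have h1 := (WithPiTopology.hasSum_iff_hasSum_coeff K).mp h.hasSum n
  simp_rw [coeff_C_mul_X_pow_eq_ite] at h1
  have h2 : HasSum (fun a => if size a = n then φ a else 0)
      (∑ a ∈ s, if size a = n then φ a else 0) := by
    refine hasSum_sum_of_ne_finset_zero fun a ha => ?_
    split_ifs with hn
    · exact hs' a hn ha
    · rfl
  rw [h1.unique h2]
  exact sum_congr rfl fun a ha => if_pos (hs a ha)

theorem HasGenFun.congr {α : Type*} {size size' : α → ℕ} {φ ψ : α → K} {F : K⟦X⟧}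
    (h : HasGenFun size φ F) (hsize : ∀ a, size a = size' a) (hφ : ∀ a, φ a = ψ a) :
    HasGenFun size' ψ F := by
  rwa [← funext hsize, ← funext hφ]

theorem HasGenFun.comp_equiv {α β : Type*} {size : α → ℕ} {φ : α → K} {F : K⟦X⟧}
    (h : HasGenFun size φ F) (e : β ≃ α) : HasGenFun (size ∘ e) (φ ∘ e) F :=
  ⟨fun n => (h.finite n).preimage e.injective.injOn, e.hasSum_iff.mpr h.hasSum⟩

variable [IsTopologicalRing K] [T2Space K]

/-- Multiplying two sums requires summability of the family of products; this follows from
finiteness in each size, which is why `HasGenFun` carries that field. -/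
theorem HasGenFun.mul {α β : Type*} {size₁ : α → ℕ} {size₂ : β → ℕ} {φ : α → K} {ψ : β → K}
    {F G : K⟦X⟧} (hF : HasGenFun size₁ φ F) (hG : HasGenFun size₂ ψ G) :
    HasGenFun (fun x : α × β => size₁ x.1 + size₂ x.2) (fun x => φ x.1 * ψ x.2) (F * G) := by
  have hfin : ∀ n, {x : α × β | size₁ x.1 + size₂ x.2 ≤ n}.Finite := fun n =>
    ((hF.finite n).prod (hG.finite n)).subset fun x (hx : _ ≤ n) =>
      ⟨show _ ≤ n by omega, show _ ≤ n by omega⟩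
  have he : (fun x : α × β => (C (φ x.1 * ψ x.2) * X ^ (size₁ x.1 + size₂ x.2) : K⟦X⟧)) =
      fun x => C (φ x.1) * X ^ size₁ x.1 * (C (ψ x.2) * X ^ size₂ x.2) := by
    funext x
    rw [map_mul, pow_add]
    ring
  have hs := summable_of_finite_size_le (fun x : α × β => φ x.1 * ψ x.2) hfin
  rw [he] at hs
  have : T3Space K⟦X⟧ := inferInstance
  have hmul := HasSum.mul hF.hasSum hG.hasSum hs
  refine ⟨hfin, ?_⟩
  rw [he]
  exact hmul

theorem HasGenFun.expand {α : Type*} {size : α → ℕ} {φ : α → K} {F : K⟦X⟧}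
    (h : HasGenFun size φ F) {p : ℕ} (hp : p ≠ 0) :
    HasGenFun (fun a => p * size a) φ (PowerSeries.expand p hp F) := by
  refine ⟨fun n => (h.finite n).subset fun a (ha : p * size a ≤ n) =>
    (Nat.le_mul_of_pos_left _ (Nat.pos_of_ne_zero hp)).trans ha, ?_⟩
  have := h.hasSum.map (PowerSeries.expand (R := K) p hp) (continuous_expand p hp)
  convert this using 2 with a
  rw [Function.comp_apply, map_mul, map_pow, expand_C, expand_X, pow_mul]

end HasGenFun

/-! ### The generating functions of the components -/

section Components

open Nat.Partition

variable {K : Type*} [Field K] [TopologicalSpace K]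

theorem hasGenFun_ptn (φ : Ptn → K) :
    HasGenFun Ptn.size φ (PowerSeries.mk fun n => ∑ p : n.Partition, φ ⟨n, p⟩) := by
  classical
  refine ⟨finite_ptn_size_le, (WithPiTopology.hasSum_iff_hasSum_coeff K).mpr fun n => ?_⟩
  simp_rw [coeff_C_mul_X_pow_eq_ite, coeff_mk]
  have h : ∑ p : n.Partition, φ ⟨n, p⟩ =
      ∑ l ∈ (univ : Finset n.Partition).map (Function.Embedding.sigmaMk n),
        if Ptn.size l = n then φ l else 0 := by
    rw [sum_map]
    exact sum_congr rfl fun p _ => (if_pos (Ptn.size_eq_fst ⟨n, p⟩)).symm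
  rw [h]
  refine hasSum_sum_of_ne_finset_zero fun l hl => if_neg fun hn => hl ?_
  obtain ⟨m, p⟩ := l
  rw [Ptn.size_eq_fst] at hn
  obtain rfl : m = n := hn
  exact mem_map.mpr ⟨p, mem_univ _, rfl⟩

theorem hasGenFun_genFun {f : ℕ → ℕ → K} {φ : Ptn → K}
    (h : ∀ l : Ptn, φ l = (Multiset.toFinsupp l.parts).prod f) :
    HasGenFun Ptn.size φ (genFun f) := by
  have := hasGenFun_ptn φ
  simp_rw [h] at this
  exact this

theorem Ptn.eq_of_parts_eq {l l' : Ptn} (h : l.parts = l'.parts) : l = l' := by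
  have h1 : l.1 = l'.1 := by
    rw [← Ptn.size_eq_fst, ← Ptn.size_eq_fst, Ptn.size, Ptn.size, h]
  obtain ⟨n, p⟩ := l
  obtain ⟨m, p'⟩ := l'
  obtain rfl : n = m := h1
  rw [Nat.Partition.ext (show p.parts = p'.parts from h)]

variable [IsTopologicalRing K]

/-- The partition `1` has crank `-1`; its term `z⁻¹q` becomes `-q`, and the two extra copies add `zq
+ z⁻¹q`. The net change `-(1 - z)q` is the correction in `crankGenFun_mul`. -/
theorem hasGenFun_pStar (z : K) :
    HasGenFun PStar.size (fun s => (s.weight : K) * z ^ s.crank)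
      (crankGenFun z - (1 - C z) * X) := by
  classical
  refine ⟨finite_pStar_size_le, ?_⟩
  set one : Ptn := ⟨1, ⟨{1}, by simp, by simp⟩⟩ with h_one
  have hone : one.parts = {1} := rfl
  have hones : one.size = 1 := Ptn.size_eq_fst _
  have hcrank : one.crank = -1 := by simp [Ptn.crank, Ptn.ones, Ptn.mu, hone]
  have h1 := (hasGenFun_ptn fun l => z ^ l.crank).hasSum
  have h2 : HasSum (fun l : Ptn => if l = one then (-1 - C z⁻¹) * X else (0 : K⟦X⟧))
    ((-1 - C z⁻¹) * X) := hasSum_ite_eq _ _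
  have h3 : HasSum (fun s : PStar => match s with
      | .ordinary l => C (z ^ l.crank) * X ^ l.size +
          (if l = one then (-1 - C z⁻¹) * X else (0 : K⟦X⟧))
      | _ => 0) (crankGenFun z + (-1 - C z⁻¹) * X) := by
    have hinj : Function.Injective PStar.ordinary := fun _ _ h => PStar.ordinary.inj h
    refine (hinj.hasSum_iff ?_).mp (h1.add h2)
    rintro (l | _ | _) hl
    · exact absurd ⟨l, rfl⟩ hl
    · rfl
    · rfl
  have h4 := hasSum_ite_eq PStar.oneStar (C z * X : K⟦X⟧)
  have h5 := hasSum_ite_eq PStar.oneStarStar (C z⁻¹ * X : K⟦X⟧)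
  have h := (h3.add h4).add h5
  convert h using 1
  · funext s
    rcases s with l | _ | _
    · by_cases hl : l.parts = {1}
      · have hl' : l = one := Ptn.eq_of_parts_eq (hl.trans hone.symm)
        subst hl'
        simp [PStar.weight, PStar.crank, PStar.size, hone, hones, hcrank]
        ring
      · have hl' : l ≠ one := fun h => hl (h ▸ hone)
        simp [PStar.weight, PStar.crank, PStar.size, hl, hl']
    · simp [PStar.weight, PStar.crank, PStar.size]
    · simp [PStar.weight, PStar.crank, PStar.size]
  · ring

variable [T2Space K]

open scoped Classical in
theorem exists_hasGenFun_oddParts (z : K) :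
    ∃ F, HasGenFun Ptn.size (fun l => if l ∈ oddParts then z ^ l.length else 0) F ∧
      F * oddProd z = 1 := by
  set t : ℕ → K := fun i => if Odd i then z else 0 with ht
  refine ⟨genFun fun i c => t i ^ c, hasGenFun_genFun fun l => ?_, ?_⟩
  · have h1 : (Multiset.toFinsupp l.parts).prod (fun i c => t i ^ c) = (l.parts.map t).prod := by
      rw [Finsupp.prod, prod_multiset_map_count]
      simp
    rw [h1, Ptn.length]
    split_ifs with h
    · have : l.parts.map t = l.parts.map fun _ => z :=
        Multiset.map_congr rfl fun i hi => if_pos (h i hi)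
      rw [this, Multiset.map_const', Multiset.prod_replicate]
    · have : ∃ i ∈ l.parts, ¬ Odd i := by simpa [oddParts] using h
      obtain ⟨i, hi, hodd⟩ := this
      exact (Multiset.prod_eq_zero (Multiset.mem_map.mpr ⟨i, hi, if_neg hodd⟩)).symm
  · have hm : Multipliable fun i : ℕ => 1 - C (t (i + 1)) * X ^ (i + 1) :=
      multipliable_one_sub fun i => (pow_dvd_pow X (by omega)).mul_left _
    have h := genFun_mul_tprod (f := fun i c => t i ^ c) (v := fun _ => 1) hm fun i =>
      one_add_tsum_geometric_mul fun _ => rfl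
    have h1 : ∀ k : ℕ, 1 - C (t (2 * k + 1)) * X ^ (2 * k + 1) =
        1 - C z * X ^ (2 * k + 1) := fun k => by rw [ht]; simp
    have h2 : ∀ k : ℕ, 1 - C (t (2 * k + 1 + 1)) * X ^ (2 * k + 1 + 1) = 1 := fun k => by
      have : ¬ Odd (2 * k + 1 + 1) := by simp [parity_simps]
      rw [ht]
      simp [this]
    rw [← tprod_even_mul_odd (f := fun i => 1 - C (t (i + 1)) * X ^ (i + 1))
      (by simp_rw [h1]; exact multipliable_oddProd z)
      (by simp_rw [h2]; exact multipliable_one)] at h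
    simp_rw [h1, h2] at h
    simpa [oddProd] using h

open scoped Classical in
theorem hasGenFun_distinctEvenParts :
    HasGenFun Ptn.size (fun l => if l ∈ distinctEvenParts then (-1 : K) ^ l.length else 0)
      (expand 2 two_ne_zero (qInf X)) := by
  set f : ℕ → ℕ → K := fun i c => if Even i ∧ c = 1 then -1 else 0 with hf
  have h : genFun f = expand 2 two_ne_zero (qInf X) := by
    have h1 := expand_qInf 2 two_ne_zero (1 : K)
    simp only [map_one, one_mul] at h1
    have hfac : ∀ i : ℕ, 1 + ∑' j, f (i + 1) (j + 1) • (X : K⟦X⟧) ^ ((i + 1) * (j + 1)) =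
        1 + C (if Even (i + 1) then (-1 : K) else 0) * X ^ (i + 1) := fun i => by
      have := one_add_tsum_single (K := K) (i := i) (c := 0) (g := f (i + 1))
        (s := if Even (i + 1) then (-1 : K) else 0) fun j => by
          simp only [hf]
          by_cases he : Even (i + 1) <;> simp [he]
      rwa [zero_add, mul_one] at this
    have h2 : ∀ k : ℕ, (1 : K⟦X⟧) + C (if Even (2 * k + 1) then (-1 : K) else 0) *
        X ^ (2 * k + 1) = 1 := fun k => by
      have : ¬ Even (2 * k + 1) := by simp
      simp [this]
    have h3 : ∀ k : ℕ, (1 : K⟦X⟧) + C (if Even (2 * k + 1 + 1) then (-1 : K) else 0) *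
        X ^ (2 * k + 1 + 1) = 1 - X ^ (2 * (k + 1)) := fun k => by
      have : Even (2 * k + 1 + 1) := by simp [parity_simps]
      rw [if_pos this, map_neg, map_one]
      ring
    have hm := multipliable_evenProd (1 : K)
    simp only [map_one, one_mul] at hm
    rw [genFun_eq_tprod, h1]
    simp_rw [hfac]
    rw [← tprod_even_mul_odd (f := fun i : ℕ => (1 : K⟦X⟧) +
        C (if Even (i + 1) then (-1 : K) else 0) * X ^ (i + 1))
      (by simp_rw [h2]; exact multipliable_one) (by simp_rw [h3]; exact hm)]
    simp_rw [h2, h3]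
    simp
  rw [← h]
  refine hasGenFun_genFun fun l => ?_
  rw [Finsupp.prod, Ptn.length]
  simp only [Multiset.toFinsupp_support, Multiset.toFinsupp_apply]
  split_ifs with hl
  · rw [prod_congr rfl fun i hi => if_pos ⟨hl.2 i (Multiset.mem_toFinset.mp hi),
      Multiset.count_eq_one_of_mem hl.1 (Multiset.mem_toFinset.mp hi)⟩, prod_const,
      Multiset.toFinset_card_of_nodup hl.1]
  · have : ∃ i ∈ l.parts, ¬ (Even i ∧ l.parts.count i = 1) := by
      by_contra! hc
      refine hl ⟨Multiset.nodup_iff_count_le_one.mpr fun i => ?_, fun i hi => (hc i hi).1⟩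
      by_cases hi : i ∈ l.parts
      · exact (hc i hi).2.le
      · rw [Multiset.count_eq_zero_of_notMem hi]
        exact zero_le_one
    obtain ⟨i, hi, hne⟩ := this
    exact (prod_eq_zero (Multiset.mem_toFinset.mpr hi) (if_neg hne)).symm

end Components

/-! ### The generating function of the vector crank -/

section Vector

/-- The components of a vector partition. -/
def vecPtnEquiv : VecPtn ≃ Ptn × Ptn × Ptn × Ptn × Ptn × PStar × PStar where
  toFun v := (v.l1, v.l2, v.l3, v.l4, v.l5, v.l6, v.l7)
  invFun x := ⟨x.1, x.2.1, x.2.2.1, x.2.2.2.1, x.2.2.2.2.1, x.2.2.2.2.2.1, x.2.2.2.2.2.2⟩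
  left_inv _ := rfl
  right_inv _ := rfl

variable {K : Type*} [Field K]

theorem zpow_vecPtn_crank {z : K} (hz : z ≠ 0) (v : VecPtn) :
    z ^ v.crank = z ^ v.l2.length * (z⁻¹ ^ v.l3.length * ((z ^ 2) ^ v.l4.length *
      ((z ^ 2)⁻¹ ^ v.l5.length * (z ^ v.l6.crank * (z ^ 2) ^ v.l7.crank)))) := by
  rw [VecPtn.crank, zpow_add₀ hz, zpow_add₀ hz, zpow_add₀ hz, zpow_sub₀ hz, zpow_mul, zpow_mul,
    zpow_sub₀ (zpow_ne_zero 2 hz)]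
  have : z ^ (2 : ℤ) = z ^ 2 := by norm_cast
  simp only [this, zpow_natCast, inv_pow]
  field_simp

variable [TopologicalSpace K] [IsTopologicalRing K] [T2Space K]

theorem expand_crankGenFun_mul {z : K} (hz : z ≠ 0) :
    expand 2 two_ne_zero (crankGenFun z - (1 - C z) * X) *
      (qInf (C z * X) * qInf (C z⁻¹ * X)) =
      expand 2 two_ne_zero (qInf X) * (oddProd z * oddProd z⁻¹) := by
  have h := congrArg (expand 2 two_ne_zero) (crankGenFun_mul hz)
  rw [map_mul, map_mul] at h
  rw [← oddProd_mul_expand z, ← oddProd_mul_expand z⁻¹, ← h]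
  ring

open scoped Classical in
/-- The generating function of the vector crank exists and is given by an infinite product. -/
theorem exists_hasGenFun_vecPtn {z : K} (hz : z ≠ 0) :
    ∃ F, HasGenFun VecPtn.size
        (fun v => if v ∈ W2 then (v.weight : K) * z ^ v.crank else 0) F ∧
      F * (qInf (C z * X) * qInf (C z⁻¹ * X) *
        (qInf (C (z ^ 2) * X) * qInf (C (z ^ 2)⁻¹ * X))) =
        expand 2 two_ne_zero (qInf X) ^ 3 := by
  obtain ⟨F₂, h₂, e₂⟩ := exists_hasGenFun_oddParts z
  obtain ⟨F₃, h₃, e₃⟩ := exists_hasGenFun_oddParts z⁻¹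
  obtain ⟨F₄, h₄, e₄⟩ := exists_hasGenFun_oddParts (z ^ 2)
  obtain ⟨F₅, h₅, e₅⟩ := exists_hasGenFun_oddParts (z ^ 2)⁻¹
  have h₁ := hasGenFun_distinctEvenParts (K := K)
  have h₆ := (hasGenFun_pStar z).expand two_ne_zero
  have h₇ := (hasGenFun_pStar (z ^ 2)).expand two_ne_zero
  have h := (h₁.mul (h₂.mul (h₃.mul (h₄.mul (h₅.mul (h₆.mul h₇)))))).comp_equiv vecPtnEquiv
  refine ⟨_, h.congr (fun v => ?_) (fun v => ?_), ?_⟩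
  · simp only [Function.comp_apply, vecPtnEquiv, Equiv.coe_fn_mk, VecPtn.size]
    ring
  · rw [zpow_vecPtn_crank hz, VecPtn.weight]
    simp only [Function.comp_apply, vecPtnEquiv, Equiv.coe_fn_mk]
    by_cases hv : v ∈ W2
    · obtain ⟨m₁, m₂, m₃, m₄, m₅⟩ := id hv
      rw [if_pos hv, if_pos m₁, if_pos m₂, if_pos m₃, if_pos m₄, if_pos m₅]
      push_cast
      ring
    · rw [if_neg hv]
      have : v.l1 ∉ distinctEvenParts ∨ v.l2 ∉ oddParts ∨ v.l3 ∉ oddParts ∨ v.l4 ∉ oddParts ∨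
          v.l5 ∉ oddParts := by
        by_contra! hc
        exact hv hc
      rcases this with m | m | m | m | m <;> simp [m]
  · have e₆ := expand_crankGenFun_mul hz
    have e₇ := expand_crankGenFun_mul (pow_ne_zero 2 hz)
    generalize expand 2 two_ne_zero (crankGenFun z - (1 - C z) * X) = F₆ at *
    generalize expand 2 two_ne_zero (crankGenFun (z ^ 2) - (1 - C (z ^ 2)) * X) = F₇ at *
    generalize qInf (C z * X) * qInf (C z⁻¹ * X) = A at *
    generalize qInf (C (z ^ 2) * X) * qInf (C (z ^ 2)⁻¹ * X) = B at *
    generalize expand 2 two_ne_zero (qInf (X : K⟦X⟧)) = E at *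
    -- One factor `E` comes from `λ₁` and one from each of `λ₆`, `λ₇`; the odd products cancel
    -- against `λ₂, …, λ₅`.
    calc E * (F₂ * (F₃ * (F₄ * (F₅ * (F₆ * F₇))))) * (A * B) =
        E * F₂ * F₃ * F₄ * F₅ * (F₆ * A) * (F₇ * B) := by ring
      _ = E ^ 3 * (F₂ * oddProd z) * (F₃ * oddProd z⁻¹) * (F₄ * oddProd (z ^ 2)) *
          (F₅ * oddProd (z ^ 2)⁻¹) := by rw [e₆, e₇]; ring
      _ = E ^ 3 := by rw [e₂, e₃, e₄, e₅]; ring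

theorem exists_coeff_eq_sum_W2Of {z : K} (hz : z ≠ 0) :
    ∃ F : K⟦X⟧, (∀ n, coeff n F = ∑ v ∈ W2Of n, (v.weight : K) * z ^ v.crank) ∧
      F * (qInf (C z * X) * qInf (C z⁻¹ * X) *
        (qInf (C (z ^ 2) * X) * qInf (C (z ^ 2)⁻¹ * X))) =
        expand 2 two_ne_zero (qInf X) ^ 3 := by
  classical
  obtain ⟨F, hF, e⟩ := exists_hasGenFun_vecPtn hz
  have hmem : ∀ {n v}, v ∈ W2Of n ↔ v ∈ W2 ∧ v.size = n := fun {n v} => by simp [W2Of]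
  refine ⟨F, fun n => ?_, e⟩
  rw [hF.coeff_eq (s := W2Of n) (fun v hv => (hmem.mp hv).2)
    fun v hn hv => if_neg fun h => hv (hmem.mpr ⟨h, hn⟩)]
  exact sum_congr rfl fun v hv => if_pos (hmem.mp hv).1

end Vector

/-! ### The generating function at a seventh root of unity -/

section RootOfUnity

variable {K : Type*} [Field K]

/-- Dividing by a series in `q^p` with constant term `1` preserves residue classes of exponents
modulo `p`. -/
theorem coeff_eq_zero_of_mul_expand {F D H : K⟦X⟧} {p r : ℕ} (hp : p ≠ 0) (hr : r < p)
    (h : F * expand p hp D = H) (hD : constantCoeff D = 1)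
    (hH : ∀ n, coeff (p * n + r) H = 0) (n : ℕ) : coeff (p * n + r) F = 0 := by
  induction n using Nat.strong_induction_on with
  | _ n ih =>
    have h1 := hH n
    rw [← h, coeff_mul, sum_eq_single (p * n + r, 0)] at h1
    · rw [coeff_zero_eq_constantCoeff_apply, constantCoeff_expand, hD, mul_one] at h1
      exact h1
    · rintro ⟨i, j⟩ hij hne
      rw [HasAntidiagonal.mem_antidiagonal] at hij
      simp only at hij ⊢
      rw [coeff_expand]
      split_ifs with hdvd
      · obtain ⟨m, rfl⟩ := hdvd
        have hm : m ≠ 0 := by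
          rintro rfl
          exact hne (by simp at hij ⊢; exact hij)
        have hmn : m ≤ n := by
          by_contra hc
          have : p * (n + 1) ≤ p * m := Nat.mul_le_mul_left p (by omega)
          rw [mul_add] at this
          omega
        obtain ⟨l, rfl⟩ : ∃ l, n = l + m := ⟨n - m, by omega⟩
        have hi : i = p * l + r := by rw [mul_add] at hij; omega
        rw [hi, ih l (by omega), zero_mul]
      · rw [mul_zero]
    · intro hc
      exact absurd (HasAntidiagonal.mem_antidiagonal.mpr (add_zero _)) hc

theorem geom_sum_eq_zero_of_pow_eq_one {w : K} (hw : w ≠ 1) {m : ℕ} (h : w ^ m = 1) :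
    ∑ k ∈ range m, w ^ k = 0 := by
  have := mul_geom_sum w m
  rw [h, sub_self] at this
  exact (mul_eq_zero.mp this).resolve_left (sub_ne_zero.mpr hw)

variable [TopologicalSpace K] [IsTopologicalRing K] [T2Space K]

/-- Factor by factor, `∏ (1 - z^k x) = 1 - x^p` over all `p`-th roots of unity, with `x = X^(i+1)`.
-/
theorem prod_qInf_eq_expand {z : K} {p : ℕ} (hz : IsPrimitiveRoot z p) (hp : p ≠ 0) :
    ∏ k ∈ range p, qInf (C (z ^ k) * X) = expand p hp (qInf X) := by
  have h1 := expand_qInf p hp (1 : K)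
  simp only [map_one, one_mul] at h1
  rw [h1]
  simp only [qInf]
  rw [← Multipliable.tprod_finsetProd fun k _ => multipliable_qInf (C (z ^ k) * X)]
  refine tprod_congr fun i => ?_
  have hC : IsPrimitiveRoot (C z : K⟦X⟧) p := hz.map_of_injective C_injective
  have := hC.pow_sub_pow_eq_prod_sub_mul 1 (X ^ (i + 1)) (Nat.pos_of_ne_zero hp)
  rw [one_pow, ← pow_mul, mul_comm (i + 1)] at this
  rw [this]
  have : NeZero p := ⟨hp⟩
  refine prod_bij (fun k _ => C z ^ k) (fun k _ => ?_) (fun k hk l hl h => ?_) (fun y hy => ?_)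
    fun k _ => ?_
  · rw [Polynomial.mem_nthRootsFinset (Nat.pos_of_ne_zero hp), ← pow_mul, mul_comm, pow_mul,
      hC.pow_eq_one, one_pow]
  · exact hC.pow_inj (mem_range.mp hk) (mem_range.mp hl) h
  · rw [Polynomial.mem_nthRootsFinset (Nat.pos_of_ne_zero hp)] at hy
    obtain ⟨k, hk, rfl⟩ := hC.eq_pow_of_pow_eq_one hy
    exact ⟨k, mem_range.mpr hk, rfl⟩
  · rw [map_pow]
    ring

theorem seven_dvd_of_two_mul_sq_add_sq {a b : ℕ} (h : 7 ∣ 2 * a ^ 2 + b ^ 2) : 7 ∣ b := by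
  have key : ∀ x y : ZMod 7, 2 * x ^ 2 + y ^ 2 = 0 → y = 0 := by decide
  rw [← ZMod.natCast_eq_zero_iff] at h ⊢
  push_cast at h
  exact key _ _ h

theorem coeff_expand_cube_mul_eq_zero {w : K} (h7 : w ^ 7 = 1) (hw : w ≠ 1) (n : ℕ) :
    coeff (7 * n + 4) (expand 2 two_ne_zero (qInf X) ^ 3 *
      (qInf X * (qInf (C w⁻¹ * X) * qInf (C w * X)))) = 0 := by
  have hw0 : w ≠ 0 := by
    rintro rfl
    simp at h7
  rw [coeff_mul]
  refine sum_eq_zero ?_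
  rintro ⟨i, j⟩ hij
  rw [HasAntidiagonal.mem_antidiagonal] at hij
  simp only at hij ⊢
  by_contra hne
  have hi := left_ne_zero_of_mul hne
  have hj := right_ne_zero_of_mul hne
  -- The cube is the triple product at `z = 1`, so its exponents are triangular numbers, doubled by
  -- `expand`.
  have hcube : expand 2 two_ne_zero (qInf X) ^ 3 = expand 2 two_ne_zero
      (qInf X * (qInf (C (1 : K)⁻¹ * X) * qInf (C 1 * X))) := by
    rw [inv_one, map_one, one_mul, ← map_pow]
    congr 1
    ring
  rw [hcube, coeff_expand] at hi
  have hdvd : 2 ∣ i := by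
    by_contra hd
    exact hi (if_neg hd)
  rw [if_pos hdvd] at hi
  obtain ⟨a, ha⟩ : ∃ a : ℕ, i / 2 = (a + 1).choose 2 := by
    by_contra! hc
    exact hi (coeff_triple_product_eq_zero one_ne_zero fun a ha => absurd ha (hc a))
  obtain ⟨b, hb, hsum⟩ : ∃ b : ℕ, j = (b + 1).choose 2 ∧ ∑ k ∈ range (2 * b + 1), w ^ k ≠ 0 := by
    by_contra! hc
    exact hj (coeff_triple_product_eq_zero hw0 hc)
  have hchoose : ∀ c : ℕ, 8 * (c + 1).choose 2 + 1 = (2 * c + 1) ^ 2 := fun c => by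
    have : ((8 * (c + 1).choose 2 + 1 : ℕ) : ℚ) = ((2 * c + 1) ^ 2 : ℕ) := by
      push_cast [Nat.cast_choose_two]
      ring
    exact_mod_cast this
  -- The form equals `8 (i + j) + 3 = 56 n + 35`.
  have hdiv : 7 ∣ 2 * (2 * a + 1) ^ 2 + (2 * b + 1) ^ 2 := by
    rw [← hchoose, ← hchoose]
    omega
  obtain ⟨m, hm⟩ := seven_dvd_of_two_mul_sq_add_sq hdiv
  exact hsum (geom_sum_eq_zero_of_pow_eq_one hw (by rw [hm, pow_mul, h7, one_pow]))

/-- The generating function of the vector crank at a primitive seventh root of unity has no terms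
with exponent congruent to `4` modulo `7`. -/
theorem sum_W2Of_primitiveRoot_eq_zero {z : K} (hz : IsPrimitiveRoot z 7) (n : ℕ) :
    ∑ v ∈ W2Of (7 * n + 4), (v.weight : K) * z ^ v.crank = 0 := by
  have h7 := hz.pow_eq_one
  have hz0 : z ≠ 0 := hz.ne_zero (by norm_num)
  obtain ⟨F, hF, e⟩ := exists_coeff_eq_sum_W2Of hz0
  rw [← hF]
  have hz3 : z ^ 3 ≠ 1 := hz.pow_ne_one_of_pos_of_lt (by norm_num) (by norm_num)
  have hinv : ∀ k l : ℕ, k + l = 7 → (z ^ k)⁻¹ = z ^ l := fun k l hkl =>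
    inv_eq_of_mul_eq_one_right (by rw [← pow_add, hkl, h7])
  have hD := prod_qInf_eq_expand hz (by norm_num : (7 : ℕ) ≠ 0)
  have i1 := hinv 1 6 rfl
  rw [pow_one] at i1
  rw [i1, hinv 2 5 rfl] at e
  have hH := coeff_expand_cube_mul_eq_zero (w := z ^ 3)
    -- The denominator of `F` uses the powers `1, 2, 5, 6` of `z`. The missing powers `0, 3, 4` form
    -- the triple product with `w = z ^ 3`.
    (by rw [← pow_mul, mul_comm, pow_mul, h7, one_pow]) hz3
  rw [hinv 3 4 rfl] at hH
  refine coeff_eq_zero_of_mul_expand (by norm_num : (7 : ℕ) ≠ 0) (by norm_num) ?_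
    (constantCoeff_qInf constantCoeff_X) hH n
  rw [← hD, ← e]
  simp only [prod_range_succ, prod_range_zero, pow_zero, pow_one, map_one, one_mul]
  ring

end RootOfUnity

/-! ### The generating function at one, and the theorem -/

section Final

variable {K : Type*} [Field K] [TopologicalSpace K] [IsTopologicalRing K] [T2Space K]

theorem continuous_map_intCast :
    Continuous (PowerSeries.map (Int.castRingHom K)) := by
  refine continuous_iff_continuousAt.mpr fun f => ?_
  rw [ContinuousAt, WithPiTopology.tendsto_iff_coeff_tendsto]
  intro d
  simp_rw [coeff_map]
  exact (continuous_of_discreteTopology.comp (WithPiTopology.continuous_coeff ℤ d)).tendsto f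

theorem map_qProd (a : ℕ) {b : ℕ} (hb : 0 < b) :
    PowerSeries.map (Int.castRingHom K) (qProd a b) = ∏' i : ℕ, (1 - X ^ (a + b * i)) := by
  rw [qProd, (multipliable_qProd a hb).map_tprod _ continuous_map_intCast]
  simp

/-- At `z = 1` the denominator is `(q)_∞⁴ = (q;q²)_∞⁴ (q²;q²)_∞⁴`, and three of the even factors
cancel against the numerator. -/
theorem sum_W2Of_weight (n : ℕ) : ∑ v ∈ W2Of n, (v.weight : K) = (w 2 n : K) := by
  obtain ⟨F, hF, e⟩ := exists_coeff_eq_sum_W2Of (one_ne_zero (α := K))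
  have hn := hF n
  simp only [one_zpow, mul_one] at hn
  rw [← hn]
  set W : K⟦X⟧ := PowerSeries.map (Int.castRingHom K) (wGenFun 2) with hW
  have hw : (w 2 n : K) = coeff n W := by
    rw [hW, coeff_map]
    rfl
  rw [hw]
  congr 1
  have h := congrArg (PowerSeries.map (Int.castRingHom K)) (wGenFun_mul_wDenom two_pos)
  have hodd : PowerSeries.map (Int.castRingHom K) (qProd 1 2) = oddProd 1 := by
    rw [map_qProd 1 two_pos, oddProd]
    exact tprod_congr fun i => by rw [map_one, one_mul, add_comm]
  have heven : PowerSeries.map (Int.castRingHom K) (qProd 2 2) =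
      expand 2 two_ne_zero (qInf X) := by
    have := expand_qInf 2 two_ne_zero (1 : K)
    simp only [map_one, one_mul] at this
    rw [map_qProd 2 two_pos, this]
    exact tprod_congr fun i => by ring
  rw [wDenom, map_mul, map_mul, map_pow, map_pow, hodd, heven, ← hW] at h
  have hA := oddProd_mul_expand (1 : K)
  simp only [one_pow, inv_one, map_one, one_mul] at e hA
  apply mul_right_cancel₀ (pow_ne_zero 4 (qInf_ne_zero (K := K) (a := X) constantCoeff_X))
  trans expand 2 two_ne_zero (qInf (X : K⟦X⟧)) ^ 3
  · rw [← e]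
    ring
  · have hA4 : qInf (X : K⟦X⟧) ^ 4 = (oddProd 1 * expand 2 two_ne_zero (qInf X)) ^ 4 := by rw [hA]
    rw [hA4]
    linear_combination -expand 2 two_ne_zero (qInf (X : K⟦X⟧)) ^ 2 * h

theorem sum_zpow_primitiveRoot {K : Type*} [Field K] {z : K} (hz : IsPrimitiveRoot z 7) (c : ℤ) :
    ∑ a ∈ range 7, (z ^ a) ^ c = if (7 : ℤ) ∣ c then 7 else 0 := by
  have h : ∀ a ∈ range 7, (z ^ a) ^ c = (z ^ c) ^ a := fun a _ => by
    rw [← zpow_natCast, ← zpow_natCast, ← zpow_mul, ← zpow_mul, mul_comm]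
  rw [sum_congr rfl h]
  have h1 := hz.zpow_eq_one_iff_dvd c
  split_ifs with hc
  · rw [h1.mpr (by exact_mod_cast hc)]
    simp
  · refine geom_sum_eq_zero_of_pow_eq_one (fun h => hc (by exact_mod_cast h1.mp h)) ?_
    rw [← zpow_natCast, ← zpow_mul, mul_comm, zpow_mul, zpow_natCast, hz.pow_eq_one, one_zpow]

theorem seven_mul_mStar (k : ℤ) (n : ℕ) : 7 * MStar k 7 (7 * n + 4) = w 2 (7 * n + 4) := by
  set N := 7 * n + 4 with hN
  have hz := Complex.isPrimitiveRoot_exp 7 (by norm_num)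
  set z := Complex.exp (2 * Real.pi * Complex.I / (7 : ℕ))
  have hz0 : z ≠ 0 := hz.ne_zero (by norm_num)
  have h : (7 * MStar k 7 N : ℂ) =
      ∑ a ∈ range 7, (z ^ a) ^ (-k) * ∑ v ∈ W2Of N, (v.weight : ℂ) * (z ^ a) ^ v.crank := by
    simp_rw [mul_sum]
    rw [sum_comm, MStar, sum_filter, Int.cast_sum, mul_sum]
    refine sum_congr rfl fun v _ => ?_
    have hterm : ∀ a ∈ range 7, (z ^ a) ^ (-k) * ((v.weight : ℂ) * (z ^ a) ^ v.crank) =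
        v.weight * (z ^ a) ^ (v.crank - k) := fun a _ => by
      rw [sub_eq_add_neg, zpow_add₀ (pow_ne_zero a hz0)]
      ring
    rw [sum_congr rfl hterm, ← mul_sum, sum_zpow_primitiveRoot hz]
    have : v.crank ≡ k [ZMOD 7] ↔ (7 : ℤ) ∣ v.crank - k :=
      Int.modEq_comm.trans Int.modEq_iff_dvd
    simp only [this]
    split_ifs
    · ring
    · simp
  -- Only the trivial character `a = 0` survives; the other six powers of `z` are primitive roots.
  rw [sum_range_succ', sum_eq_zero, zero_add, pow_zero] at h
  · simp only [one_zpow, mul_one, one_mul] at h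
    rw [sum_W2Of_weight] at h
    exact_mod_cast h
  · intro a ha
    have hcop : (a + 1).Coprime 7 :=
      (Nat.coprime_of_lt_prime (Nat.succ_ne_zero a) (by have := mem_range.mp ha; omega)
        (by norm_num : Nat.Prime 7)).symm
    rw [sum_W2Of_primitiveRoot_eq_zero (hz.pow_of_coprime _ hcop), mul_zero]

end Final

end VectorCrank

theorem mainTheorem8 (n : ℕ) :
    (∀ i j : ℕ, i < 7 → j < 7 →
      VectorCrank.MStar i 7 (7 * n + 4) = VectorCrank.MStar j 7 (7 * n + 4)) ∧
    (∀ k : ℕ, k < 7 →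
      (VectorCrank.MStar k 7 (7 * n + 4) : ℚ) = (VectorCrank.w 2 (7 * n + 4) : ℚ) / 7) := by
  refine ⟨fun i j _ _ => ?_, fun k _ => ?_⟩
  · have hi := VectorCrank.seven_mul_mStar i n
    have hj := VectorCrank.seven_mul_mStar j n
    omega
  · have hk := VectorCrank.seven_mul_mStar k n
    rw [← hk]
    push_cast
    ring
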